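/- Consider the panel regression model with interactive fixed effects $$Y=\sum_{k=1}^K\beta^0_kX_k+\lambda^0f^{0\prime}+e ,$$ where $Y,X_1,\dots,X_K,e$ are real random $N\times T$ matrices, $\lambda^0$ is $N\times R^0$, $f^0$ is $T\times R^0$ ($\lambda^0,f^0$ non-random or random), $\beta^0\in\mathbb R^K$, and $K$, $R^0$, $\beta^0$ are fixed. Write $\beta\cdot X=\sum_k\beta_kX_k$, let $\|\cdot\|$ be the Euclidean norm of a vector and the spectral norm of a matrix, and $\|A\|_{HS}=\sqrt{\mathrm{Tr}(AA')}$. Let $P_A=A(A'A)^\dagger A'$ (with $(A'A)^\dagger$ any generalized inverse) be the orthogonal projector onto the column space of $A$, and $M_A=\mathbb 1-P_A$. Define the profile least squares objective with $R^0$ factors $$\mathcal L^0_{NT}(\beta)=\min_{\Lambda\in\mathbb R^{N\times R^0},\,F\in\mathbb R^{T\times R^0}}\frac1{NT}\,\|Y-\beta\cdot X-\Lambda F'\|_{HS}^2 ,$$ the $K\times K$ matrix $W$ with entries $W_{k_1k_2}=\frac1{NT}\mathrm{Tr}(M_{\lambda^0}X_{k_1}M_{f^0}X_{k_2}')$, and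 the $K$-vectors $C^{(1)},C^{(2)}$ with entries $$C^{(1)}_k=\tfrac1{\sqrt{NT}}\mathrm{Tr}(M_{\lambda^0}X_kM_{f^0}e'),$$ $$\begin{aligned}C^{(2)}_k=-\tfrac1{\sqrt{NT}}\Big[&\mathrm{Tr}\big(eM_{f^0}e'M_{\lambda^0}X_kf^0(f^{0\prime}f^0)^{-1}(\lambda^{0\prime}\lambda^0)^{-1}\lambda^{0\prime}\big)\\&+\mathrm{Tr}\big(e'M_{\lambda^0}eM_{f^0}X_k'\lambda^0(\lambda^{0\prime}\lambda^0)^{-1}(f^{0\prime}f^0)^{-1}f^{0\prime}\big)\\&+\mathrm{Tr}\big(e'M_{\lambda^0}X_kM_{f^0}e'\lambda^0(\lambda^{0\prime}\lambda^0)^{-1}(f^{0\prime}f^0)^{-1}f^{0\prime}\big)\Big].\end{aligned}$$ Let $N,T\to\infty$ (along a sequence $(N_n,T_n)_{n\in\mathbb N}$, with all matrices depending on $n$) such that $N/T\to\kappa^2$ with $0<\kappa<\infty$, and assume: - (SF, strong factors) the probability limits of $\frac1N\lambda^{0\prime}\lambda^0$ and of $\frac1Tf^{0\prime}f^0$ exist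 and are finite, non-random, positive definite matrices; - (SN, spectral norms) $\|X_k\|=\mathcal O_P(\sqrt{NT})$ for $k=1,\dots,K$, and $\|e\|=\mathcal O_P(\sqrt{\max(N,T)})$. **Theorem 4.2.** Then, for all $\beta\in\mathbb R^K$, $$\mathcal L^0_{NT}(\beta)=\mathcal L^0_{NT}(\beta^0)-\frac2{\sqrt{NT}}(\beta-\beta^0)'\big(C^{(1)}+C^{(2)}\big)+(\beta-\beta^0)'W(\beta-\beta^0)+\mathcal L^{0,\mathrm{rem}}_{NT}(\beta),$$ where the remainder satisfies, for every (deterministic) sequence $c_{NT}\to0$, $$\sup_{\{\beta:\|\beta-\beta^0\|\le c_{NT}\}}\frac{|\mathcal L^{0,\mathrm{rem}}_{NT}(\beta)|}{\big(1+\sqrt{NT}\,\|\beta-\beta^0\|\big)^2}=o_P\!\left(\frac1{NT}\right).$$ -/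

import Mathlib

open Matrix MeasureTheory Filter Topology
open scoped ENNReal

/-- The spectral (operator) norm of a real matrix, with respect to Euclidean norms. -/
noncomputable def specNorm {m p : ℕ} (A : Matrix (Fin m) (Fin p) ℝ) : ℝ :=
  ‖LinearMap.toContinuousLinearMap (Matrix.toEuclideanLin A)‖

/-- The Hilbert-Schmidt (Frobenius) norm `‖A‖_HS = √Tr(A A')`. -/
noncomputable def hsNorm {m p : ℕ} (A : Matrix (Fin m) (Fin p) ℝ) : ℝ :=
  Real.sqrt (A * Aᵀ).trace

/-- `P_A`: the matrix of the orthogonal projection onto the column space of `A`.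
By `colProj_eq` it is `A (A'A)† A'` for every generalized inverse `(A'A)†` of `A'A`. -/
noncomputable def colProj {m p : ℕ} (A : Matrix (Fin m) (Fin p) ℝ) : Matrix (Fin m) (Fin m) ℝ :=
  Matrix.toEuclideanLin.symm
    ((LinearMap.range (Matrix.toEuclideanLin A)).starProjection).toLinearMap

theorem colProj_eq {m p : ℕ} (A : Matrix (Fin m) (Fin p) ℝ) (G : Matrix (Fin p) (Fin p) ℝ)
    (hG : Aᵀ * A * G * (Aᵀ * A) = Aᵀ * A) : colProj A = A * G * Aᵀ := by
  have key : ∀ H : Matrix (Fin p) (Fin p) ℝ, Aᵀ * A * H * (Aᵀ * A) = Aᵀ * A →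
      A * H * (Aᵀ * A) = A := by
    intro H hH
    have h0 : (A * H * (Aᵀ * A) - A)ᴴ * (A * H * (Aᵀ * A) - A) = 0 := by
      have h1 : Aᵀ * (A * H * (Aᵀ * A) - A) = 0 := by
        rw [Matrix.mul_sub, sub_eq_zero]
        simpa only [Matrix.mul_assoc] using hH
      have h2 : A * H * (Aᵀ * A) - A = A * (H * (Aᵀ * A) - 1) := by
        rw [Matrix.mul_sub, Matrix.mul_one, Matrix.mul_assoc]
      conv_lhs => arg 1; rw [h2]
      rw [Matrix.conjTranspose_eq_transpose_of_trivial, Matrix.transpose_mul, Matrix.mul_assoc, h1,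
        Matrix.mul_zero]
    exact sub_eq_zero.1 (Matrix.conjTranspose_mul_self_eq_zero.1 h0)
  have hGt : Aᵀ * A * Gᵀ * (Aᵀ * A) = Aᵀ * A := by
    have := congrArg Matrix.transpose hG
    simpa [Matrix.transpose_mul, Matrix.mul_assoc] using this
  have hA : Aᵀ * (A * G * Aᵀ) = Aᵀ := by
    have := congrArg Matrix.transpose (key _ hGt)
    simpa [Matrix.transpose_mul, Matrix.mul_assoc] using this
  rw [colProj, LinearEquiv.symm_apply_eq]
  ext1 v
  refine Submodule.eq_starProjection_of_mem_of_inner_eq_zero ?_ ?_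
  · refine ⟨WithLp.toLp 2 ((G * Aᵀ) *ᵥ v.ofLp), ?_⟩
    rw [Matrix.toLpLin_apply, Matrix.toLpLin_apply, Matrix.mulVec_mulVec, ← Matrix.mul_assoc]
  · rintro _ ⟨u, rfl⟩
    have hz : Aᵀ *ᵥ (v.ofLp - (A * G * Aᵀ) *ᵥ v.ofLp) = 0 := by
      rw [Matrix.mulVec_sub, Matrix.mulVec_mulVec, hA, sub_self]
    have h3 : (v.ofLp - (A * G * Aᵀ) *ᵥ v.ofLp) ⬝ᵥ (A *ᵥ u.ofLp) = 0 := by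
      rw [Matrix.dotProduct_mulVec, ← Matrix.mulVec_transpose, hz, zero_dotProduct]
    rw [dotProduct_comm] at h3
    simpa [EuclideanSpace.inner_eq_star_dotProduct, Matrix.toEuclideanLin, Matrix.mul_assoc] using h3

/-- `M_A = 1 - P_A`. -/
noncomputable def annih {m p : ℕ} (A : Matrix (Fin m) (Fin p) ℝ) : Matrix (Fin m) (Fin m) ℝ :=
  1 - colProj A

section Panel

/-- `β · X = ∑ₖ βₖ Xₖ`. -/
noncomputable def lincomb {K N T : ℕ} (β : EuclideanSpace ℝ (Fin K))
    (X : Fin K → Matrix (Fin N) (Fin T) ℝ) : Matrix (Fin N) (Fin T) ℝ :=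
  ∑ k, β k • X k

/-- The outcome matrix `Y = β⁰ · X + λ⁰ f⁰' + e` of the model. -/
noncomputable def outcome {K R N T : ℕ} (β0 : EuclideanSpace ℝ (Fin K))
    (X : Fin K → Matrix (Fin N) (Fin T) ℝ) (lam : Matrix (Fin N) (Fin R) ℝ)
    (f : Matrix (Fin T) (Fin R) ℝ) (e : Matrix (Fin N) (Fin T) ℝ) : Matrix (Fin N) (Fin T) ℝ :=
  lincomb β0 X + lam * fᵀ + e

/-- The profile least squares objective with `R` factors,
`L^R(β) = min_{Λ, F} (1/NT) ‖Y - β · X - Λ F'‖_HS²`. -/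
noncomputable def profileObj {K N T : ℕ} (R : ℕ) (Y : Matrix (Fin N) (Fin T) ℝ)
    (X : Fin K → Matrix (Fin N) (Fin T) ℝ) (β : EuclideanSpace ℝ (Fin K)) : ℝ :=
  ⨅ p : Matrix (Fin N) (Fin R) ℝ × Matrix (Fin T) (Fin R) ℝ,
    1 / ((N : ℝ) * T) * hsNorm (Y - lincomb β X - p.1 * p.2ᵀ) ^ 2

/-- `W_{k₁k₂} = (1/NT) Tr(M_λ X_{k₁} M_f X_{k₂}')`. -/
noncomputable def matW {K R N T : ℕ} (X : Fin K → Matrix (Fin N) (Fin T) ℝ)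
    (lam : Matrix (Fin N) (Fin R) ℝ) (f : Matrix (Fin T) (Fin R) ℝ) : Matrix (Fin K) (Fin K) ℝ :=
  Matrix.of fun k₁ k₂ =>
    1 / ((N : ℝ) * T) * (annih lam * X k₁ * annih f * (X k₂)ᵀ).trace

/-- `C⁽¹⁾ₖ = (NT)^{-1/2} Tr(M_λ Xₖ M_f e')`. -/
noncomputable def vecC1 {K R N T : ℕ} (X : Fin K → Matrix (Fin N) (Fin T) ℝ)
    (lam : Matrix (Fin N) (Fin R) ℝ) (f : Matrix (Fin T) (Fin R) ℝ)
    (e : Matrix (Fin N) (Fin T) ℝ) (k : Fin K) : ℝ :=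
  1 / Real.sqrt ((N : ℝ) * T) * (annih lam * X k * annih f * eᵀ).trace

/-- `C⁽²⁾ₖ`, the term that is linear in `Xₖ` and quadratic in `e`. -/
noncomputable def vecC2 {K R N T : ℕ} (X : Fin K → Matrix (Fin N) (Fin T) ℝ)
    (lam : Matrix (Fin N) (Fin R) ℝ) (f : Matrix (Fin T) (Fin R) ℝ)
    (e : Matrix (Fin N) (Fin T) ℝ) (k : Fin K) : ℝ :=
  -(1 / Real.sqrt ((N : ℝ) * T)) *
    ((e * annih f * eᵀ * annih lam * X k * f * (fᵀ * f)⁻¹ * (lamᵀ * lam)⁻¹ * lamᵀ).trace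
      + (eᵀ * annih lam * e * annih f * (X k)ᵀ * lam * (lamᵀ * lam)⁻¹ * (fᵀ * f)⁻¹ * fᵀ).trace
      + (eᵀ * annih lam * X k * annih f * eᵀ * lam * (lamᵀ * lam)⁻¹ * (fᵀ * f)⁻¹ * fᵀ).trace)

end Panel

section Asymptotics

/-- `Z n = O_P(a n)`. -/
def IsBigOP {Ω : Type*} [MeasurableSpace Ω] (P : Measure Ω) (Z : ℕ → Ω → ℝ) (a : ℕ → ℝ) : Prop :=
  ∀ ε : ℝ, 0 < ε → ∃ M : ℝ, ∀ᶠ n in atTop, P.real {ω | M * |a n| < |Z n ω|} ≤ ε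

/-- `Z n = o_P(a n)` for `[0, ∞]`-valued `Z`: for each `ε > 0` the probability that
`Z n > ε a n` tends to `0`. -/
def IsLittleOP {Ω : Type*} [MeasurableSpace Ω] (P : Measure Ω) (Z : ℕ → Ω → ℝ≥0∞)
    (a : ℕ → ℝ) : Prop :=
  ∀ ε : ℝ, 0 < ε →
    Tendsto (fun n => P {ω | ENNReal.ofReal (ε * |a n|) < Z n ω}) atTop (𝓝 0)

/-- The probability limit of the random matrices `A n` exists and is a (finite, non-random)
positive definite matrix. Matrices converge in probability entry by entry. -/
def PlimPosDef {Ω : Type*} [MeasurableSpace Ω] (P : Measure Ω) {R : ℕ}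
    (A : ℕ → Ω → Matrix (Fin R) (Fin R) ℝ) : Prop :=
  ∃ S : Matrix (Fin R) (Fin R) ℝ, S.PosDef ∧
    ∀ r s, TendstoInMeasure P (fun n ω => A n ω r s) atTop (fun _ => S r s)

/-- Strong factor assumption:
`0 < plim λ⁰'λ⁰/N < ∞` and `0 < plim f⁰'f⁰/T < ∞`. -/
structure StrongFactors {Ω : Type*} [MeasurableSpace Ω] (P : Measure Ω) {R : ℕ} {N T : ℕ → ℕ}
    (lam0 : ∀ n, Ω → Matrix (Fin (N n)) (Fin R) ℝ)
    (f0 : ∀ n, Ω → Matrix (Fin (T n)) (Fin R) ℝ) : Prop where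
  loadings : PlimPosDef P fun n ω => (1 / (N n : ℝ)) • ((lam0 n ω)ᵀ * lam0 n ω)
  factors : PlimPosDef P fun n ω => (1 / (T n : ℝ)) • ((f0 n ω)ᵀ * f0 n ω)

/-- Spectral norm assumption: `‖Xₖ‖ = O_P(√(NT))` for each `k`, and `‖e‖ = O_P(√max(N,T))`. -/
structure SpectralNormBounds {Ω : Type*} [MeasurableSpace Ω] (P : Measure Ω) {K : ℕ} {N T : ℕ → ℕ}
    (X : ∀ n, Fin K → Ω → Matrix (Fin (N n)) (Fin (T n)) ℝ)
    (e : ∀ n, Ω → Matrix (Fin (N n)) (Fin (T n)) ℝ) : Prop where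
  regressors : ∀ k, IsBigOP P (fun n ω => specNorm (X n k ω))
    (fun n => Real.sqrt ((N n : ℝ) * T n))
  errors : IsBigOP P (fun n ω => specNorm (e n ω))
    (fun n => Real.sqrt (max (N n : ℝ) (T n)))

end Asymptotics

/-! ### Spectral and Hilbert-Schmidt norms, orthogonal projections, low-rank trace bounds -/

section MatrixNorms

open scoped Matrix.Norms.L2Operator

/-! Profiling out the factors turns `NT` times the objective at `β` into the squared Hilbert-Schmidt
distance from `λ⁰f⁰' + e + D` to the matrices of rank at most `R⁰`, with `D = (β⁰ - β)·X`. The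
theorem is therefore a perturbation statement about low-rank approximation, proved deterministically
with explicit constants.

If a matrix has a well-conditioned leading block of rank `R` and small off-diagonal blocks, this
distance is the squared norm of the trailing block, up to an error quadratic in the off-diagonal
blocks (`abs_lowRankDist_sub_le`). The upper bound comes from the Schur complement, the lower bound
from a perturbed Ky Fan principle (`hsSq_proj_mul_le`). Relative to the column and row spaces of
`λ⁰f⁰'` the off-diagonal blocks of `λ⁰f⁰' + e` are of order `‖e‖`, which is too large. The spaces
are therefore tilted by a correction of second order in `e` (`graphSlope`), which makes these blocks
cubic in `e` (`norm_off_diagonal_le`). The tilt does not depend on `β`, so it serves at `β` and at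
`β⁰`: in the difference of the two distances the part free of `D` cancels. Expanding the residual to
second order (`norm_residual_sub_le`) gives `C⁽¹⁾ + C⁽²⁾` in the part linear in `D`; the quadratic
part gives `W`. All corrections have rank at most a multiple of `R`, so spectral norms control them.

With `l`, `a`, `d` bounding the norms of the pseudo-inverse of `λ⁰f⁰'`, of `e` and of `D`, the total
error is a constant times `R (l a + l d + l² a³)(1 + d)²` (`abs_lowRankDist_expansion_le`). Here `l`
is of order `(NT)^(-1/2)`, `a` of order `√max(N,T)` and `d` of order `√(NT) ‖β - β⁰‖`, so the first
bracket vanishes on shrinking balls and `(1 + d)²` is absorbed by the normalization. Probability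
enters only through a union bound. -/

theorem specNorm_eq_norm {m p : ℕ} (A : Matrix (Fin m) (Fin p) ℝ) : specNorm A = ‖A‖ :=
  (Matrix.l2_opNorm_def A).symm

theorem norm_transpose_l2 {m p : ℕ} (A : Matrix (Fin m) (Fin p) ℝ) : ‖Aᵀ‖ = ‖A‖ := by
  rw [← Matrix.conjTranspose_eq_transpose_of_trivial, Matrix.l2_opNorm_conjTranspose]

theorem norm_mul_le_of_le_l2 {m p q : ℕ} {A : Matrix (Fin m) (Fin p) ℝ}
    {B : Matrix (Fin p) (Fin q) ℝ} {a b : ℝ} (hA : ‖A‖ ≤ a) (hB : ‖B‖ ≤ b) :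
    ‖A * B‖ ≤ a * b :=
  (Matrix.l2_opNorm_mul A B).trans
    (mul_le_mul hA hB (norm_nonneg _) ((norm_nonneg _).trans hA))

/-- The squared Hilbert-Schmidt norm. -/
noncomputable def hsSq {m p : ℕ} (A : Matrix (Fin m) (Fin p) ℝ) : ℝ := (A * Aᵀ).trace

theorem trace_mul_transpose_eq_sum {m p : ℕ} (A B : Matrix (Fin m) (Fin p) ℝ) :
    (A * Bᵀ).trace = ∑ i, ∑ j, A i j * B i j := by
  simp [Matrix.trace, Matrix.mul_apply]

theorem hsSq_eq_sum {m p : ℕ} (A : Matrix (Fin m) (Fin p) ℝ) :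
    hsSq A = ∑ i, ∑ j, A i j ^ 2 := by
  simp [hsSq, trace_mul_transpose_eq_sum, sq]

theorem hsSq_nonneg {m p : ℕ} (A : Matrix (Fin m) (Fin p) ℝ) : 0 ≤ hsSq A := by
  rw [hsSq_eq_sum]; positivity

theorem hsNorm_sq {m p : ℕ} (A : Matrix (Fin m) (Fin p) ℝ) : hsNorm A ^ 2 = hsSq A :=
  Real.sq_sqrt (hsSq_nonneg A)

theorem hsSq_transpose {m p : ℕ} (A : Matrix (Fin m) (Fin p) ℝ) : hsSq Aᵀ = hsSq A := by
  rw [hsSq, hsSq, Matrix.transpose_transpose, Matrix.trace_mul_comm]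

theorem hsSq_neg {m p : ℕ} (A : Matrix (Fin m) (Fin p) ℝ) : hsSq (-A) = hsSq A := by
  simp [hsSq]

theorem trace_mul_transpose_comm {m p : ℕ} (A B : Matrix (Fin m) (Fin p) ℝ) :
    (A * Bᵀ).trace = (B * Aᵀ).trace := by
  rw [← Matrix.trace_transpose, Matrix.transpose_mul, Matrix.transpose_transpose]

theorem hsSq_add {m p : ℕ} (A B : Matrix (Fin m) (Fin p) ℝ) :
    hsSq (A + B) = hsSq A + 2 * (A * Bᵀ).trace + hsSq B := by
  have := trace_mul_transpose_comm A B
  simp only [hsSq, Matrix.transpose_add, Matrix.add_mul, Matrix.mul_add, Matrix.trace_add]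
  linarith

theorem hsSq_sub {m p : ℕ} (A B : Matrix (Fin m) (Fin p) ℝ) :
    hsSq (A - B) = hsSq A - 2 * (A * Bᵀ).trace + hsSq B := by
  rw [sub_eq_add_neg, hsSq_add, hsSq_neg]
  simp
  ring

theorem sq_trace_mul_transpose_le {m p : ℕ} (A B : Matrix (Fin m) (Fin p) ℝ) :
    (A * Bᵀ).trace ^ 2 ≤ hsSq A * hsSq B := by
  rw [trace_mul_transpose_eq_sum, hsSq_eq_sum, hsSq_eq_sum]
  simp only [← Fintype.sum_prod_type']
  exact Finset.sum_mul_sq_le_sq_mul_sq _ _ _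

theorem hsSq_mul_le {m p q : ℕ} (A : Matrix (Fin m) (Fin p) ℝ) (B : Matrix (Fin p) (Fin q) ℝ) :
    hsSq (A * B) ≤ ‖A‖ ^ 2 * hsSq B := by
  have col : ∀ {r : ℕ} (C : Matrix (Fin r) (Fin q) ℝ),
      hsSq C = ∑ j, ‖WithLp.toLp 2 (fun i => C i j)‖ ^ 2 := by
    intro r C
    rw [hsSq_eq_sum, Finset.sum_comm]
    simp [EuclideanSpace.norm_sq_eq]
  rw [col, col, Finset.mul_sum]
  refine Finset.sum_le_sum fun j _ => ?_
  have h := Matrix.l2_opNorm_mulVec A (WithLp.toLp 2 (fun i => B i j))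
  rw [← mul_pow]
  refine pow_le_pow_left₀ (norm_nonneg _) ?_ 2
  exact h

theorem hsSq_mul_le' {m p q : ℕ} (A : Matrix (Fin m) (Fin p) ℝ) (B : Matrix (Fin p) (Fin q) ℝ) :
    hsSq (A * B) ≤ hsSq A * ‖B‖ ^ 2 := by
  rw [← hsSq_transpose, Matrix.transpose_mul, ← hsSq_transpose A, ← norm_transpose_l2 B, mul_comm]
  exact hsSq_mul_le _ _

/-- Symmetric idempotent matrices, i.e. orthogonal projections. -/
structure IsOrthProj {m : ℕ} (P : Matrix (Fin m) (Fin m) ℝ) : Prop where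
  symm : Pᵀ = P
  idem : P * P = P

namespace IsOrthProj

variable {m p : ℕ} {P : Matrix (Fin m) (Fin m) ℝ}

theorem compl (h : IsOrthProj P) : IsOrthProj (1 - P) where
  symm := by rw [Matrix.transpose_sub, h.symm, Matrix.transpose_one]
  idem := by
    simp [Matrix.mul_sub, Matrix.sub_mul, h.idem]

theorem mul_compl (h : IsOrthProj P) : P * (1 - P) = 0 := by
  rw [Matrix.mul_sub, h.idem, Matrix.mul_one, sub_self]

theorem compl_mul (h : IsOrthProj P) : (1 - P) * P = 0 := by
  rw [Matrix.sub_mul, h.idem, Matrix.one_mul, sub_self]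

theorem norm_le_one (h : IsOrthProj P) : ‖P‖ ≤ 1 := by
  have h1 := Matrix.l2_opNorm_conjTranspose_mul_self P
  rw [Matrix.conjTranspose_eq_transpose_of_trivial, h.symm, h.idem] at h1
  by_contra! h2
  nlinarith

theorem hsSq_eq (h : IsOrthProj P) : hsSq P = P.trace := by
  rw [hsSq, h.symm, h.idem]

theorem hsSq_mul_eq (h : IsOrthProj P) (A : Matrix (Fin m) (Fin p) ℝ) :
    hsSq (P * A) = (P * (A * Aᵀ)).trace := by
  rw [hsSq, Matrix.transpose_mul, h.symm, ← Matrix.mul_assoc, Matrix.trace_mul_comm,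
    ← Matrix.mul_assoc, ← Matrix.mul_assoc, h.idem, Matrix.mul_assoc]

theorem hsSq_split (h : IsOrthProj P) (A : Matrix (Fin m) (Fin p) ℝ) :
    hsSq A = hsSq (P * A) + hsSq ((1 - P) * A) := by
  rw [h.hsSq_mul_eq, h.compl.hsSq_mul_eq, ← Matrix.trace_add, ← Matrix.add_mul]
  simp [hsSq]

theorem hsSq_mul_le_self (h : IsOrthProj P) (A : Matrix (Fin m) (Fin p) ℝ) :
    hsSq (P * A) ≤ hsSq A := by
  have := h.hsSq_split A
  have := hsSq_nonneg ((1 - P) * A)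
  linarith

theorem trace_nonneg (h : IsOrthProj P) : 0 ≤ P.trace := h.hsSq_eq ▸ hsSq_nonneg P

/-- The trace of a projection is its rank, so passing from the spectral to the Hilbert-Schmidt norm
costs a factor of the rank and not of the dimension. This is why the error terms scale with `R`
only. -/
theorem hsSq_mul_le_trace (h : IsOrthProj P) (A : Matrix (Fin m) (Fin p) ℝ) :
    hsSq (P * A) ≤ P.trace * ‖P * A‖ ^ 2 := by
  have h1 : P * A = P * (P * A) := by rw [← Matrix.mul_assoc, h.idem]
  rw [h1, ← h.hsSq_eq, ← h1]
  conv_lhs => rw [h1]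
  exact hsSq_mul_le' _ _

end IsOrthProj

theorem trace_eq_rank_of_idem {m : ℕ} {P : Matrix (Fin m) (Fin m) ℝ} (h : P * P = P) :
    P.trace = P.rank := by
  have h1 : IsIdempotentElem (Matrix.toLin' P) := by
    rw [IsIdempotentElem, Module.End.mul_eq_comp, ← Matrix.toLin'_mul, h]
  rw [← Matrix.trace_toLin'_eq, (LinearMap.IsIdempotentElem.isProj_range _ h1).trace]
  rfl

theorem colProj_mem {m p : ℕ} (A : Matrix (Fin m) (Fin p) ℝ) :
    ∃ G : Matrix (Fin p) (Fin m) ℝ, colProj A = A * G := by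
  have h : ∀ x, ∃ y, Matrix.toEuclideanLin A y = Matrix.toEuclideanLin (colProj A) x := by
    intro x
    rw [colProj, LinearEquiv.apply_symm_apply]
    exact Submodule.starProjection_apply_mem (LinearMap.range (Matrix.toEuclideanLin A)) x
  choose y hy using h
  refine ⟨Matrix.of fun i j => (y (EuclideanSpace.single j 1)).ofLp i, ?_⟩
  ext i j
  have := congrArg (fun v => v.ofLp i) (hy (EuclideanSpace.single j 1))
  simp only [Matrix.toLpLin_apply] at this
  simp only [Matrix.mul_apply, Matrix.of_apply]
  simpa [Matrix.mulVec, dotProduct] using this.symm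

theorem colProj_mul_self {m p : ℕ} (A : Matrix (Fin m) (Fin p) ℝ) : colProj A * A = A := by
  apply Matrix.toEuclideanLin.injective
  ext1 x
  have : Matrix.toEuclideanLin (colProj A * A) x
      = Matrix.toEuclideanLin (colProj A) (Matrix.toEuclideanLin A x) := by
    simp [Matrix.toLpLin_apply, Matrix.mulVec_mulVec]
  rw [this, colProj, LinearEquiv.apply_symm_apply]
  exact Submodule.starProjection_eq_self_iff.2 ⟨x, rfl⟩

theorem isOrthProj_colProj {m p : ℕ} (A : Matrix (Fin m) (Fin p) ℝ) : IsOrthProj (colProj A) where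
  symm := by
    have h : ∀ x y : EuclideanSpace ℝ (Fin m),
        inner ℝ (Matrix.toEuclideanLin (colProj A) x) y
          = inner ℝ x (Matrix.toEuclideanLin (colProj A) y) := by
      intro x y
      rw [colProj, LinearEquiv.apply_symm_apply]
      exact Submodule.inner_starProjection_left_eq_right _ x y
    ext i j
    have := h (EuclideanSpace.single i 1) (EuclideanSpace.single j 1)
    simpa [EuclideanSpace.inner_eq_star_dotProduct, Matrix.toLpLin_apply] using this
  idem := by
    obtain ⟨G, hG⟩ := colProj_mem A
    calc colProj A * colProj A = colProj A * A * G := by rw [Matrix.mul_assoc, ← hG]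
      _ = colProj A := by rw [colProj_mul_self, ← hG]

theorem trace_colProj_le {m p : ℕ} (A : Matrix (Fin m) (Fin p) ℝ) :
    (colProj A).trace ≤ A.rank := by
  rw [trace_eq_rank_of_idem (isOrthProj_colProj A).idem]
  obtain ⟨G, hG⟩ := colProj_mem A
  rw [hG]
  exact_mod_cast Matrix.rank_mul_le_left A G

/-- Cauchy-Schwarz for the Hilbert-Schmidt pairing of `A * B` with `P`, which can be inserted into
the trace because `P * A = A`. -/
theorem IsOrthProj.abs_trace_le {m : ℕ} {P : Matrix (Fin m) (Fin m) ℝ} (h : IsOrthProj P)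
    {p : ℕ} (A : Matrix (Fin m) (Fin p) ℝ) (B : Matrix (Fin p) (Fin m) ℝ) (hA : P * A = A) :
    |(A * B).trace| ≤ P.trace * (‖A‖ * ‖B‖) := by
  have h1 : (A * B).trace = ((A * B) * Pᵀ).trace := by
    rw [h.symm, Matrix.trace_mul_comm (A * B), ← Matrix.mul_assoc, hA]
  have h2 : A * B = P * (A * B) := by rw [← Matrix.mul_assoc, hA]
  have h3 : hsSq (A * B) ≤ P.trace * (‖A‖ * ‖B‖) ^ 2 := by
    rw [h2]
    refine (h.hsSq_mul_le_trace _).trans ?_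
    rw [← h2]
    exact mul_le_mul_of_nonneg_left
      (pow_le_pow_left₀ (norm_nonneg _) (Matrix.l2_opNorm_mul A B) 2) h.trace_nonneg
  rw [h1]
  apply abs_le_of_sq_le_sq _ (mul_nonneg h.trace_nonneg (by positivity))
  refine (sq_trace_mul_transpose_le _ _).trans ?_
  rw [h.hsSq_eq]
  nlinarith [h.trace_nonneg]

theorem abs_trace_mul_le_rank {m p : ℕ} (A : Matrix (Fin m) (Fin p) ℝ)
    (B : Matrix (Fin p) (Fin m) ℝ) : |(A * B).trace| ≤ A.rank * (‖A‖ * ‖B‖) :=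
  ((isOrthProj_colProj A).abs_trace_le A B (colProj_mul_self A)).trans
    (mul_le_mul_of_nonneg_right (trace_colProj_le A) (by positivity))

end MatrixNorms

/-! ### Ky Fan perturbation, projections onto graphs, block inverses, low-rank distance -/

section BlockPerturbation

open scoped Matrix.Norms.L2Operator

/-- A perturbation form of Ky Fan's maximum principle: if the compression of `A` to the range of
`P` is bounded below, its complement is small and `P` almost commutes with `A Aᵀ`, then no
projection of at most the same rank captures much more of `A` than `P` does. -/
theorem hsSq_proj_mul_le {m n : ℕ} {A : Matrix (Fin m) (Fin n) ℝ}
    {P S : Matrix (Fin m) (Fin m) ℝ} (hP : IsOrthProj P) (hS : IsOrthProj S)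
    (htr : S.trace ≤ P.trace) (W : Matrix (Fin n) (Fin m) ℝ) (hW : P * A * W = P)
    {j z κ : ℝ} (hj : 0 < j) (hWj : ‖W‖ ≤ j) (hz : ‖(1 - P) * A‖ ≤ z)
    (hκ : hsSq (P * (A * Aᵀ) * (1 - P)) ≤ κ) (hjz : j * z ≤ 1 / 2) :
    hsSq (S * A) ≤ hsSq (P * A) + 2 * j ^ 2 * κ := by
  have hz0 : 0 ≤ z := (norm_nonneg _).trans hz
  have hκ0 : 0 ≤ κ := (hsSq_nonneg _).trans hκ
  have h1 := hS.hsSq_split (P * A)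
  have hq : hsSq ((1 - S) * P) ≤ hsSq ((1 - S) * (P * A)) * j ^ 2 := by
    have : (1 - S) * P = (1 - S) * (P * A) * W := by
      rw [Matrix.mul_assoc, hW]
    rw [this]
    exact (hsSq_mul_le' _ _).trans (mul_le_mul_of_nonneg_left
      (pow_le_pow_left₀ (norm_nonneg _) hWj 2) (hsSq_nonneg _))
  -- The trace hypothesis enters here: the two sides are `S.trace` and `P.trace`, each reduced by
  -- `(S * P).trace`.
  have hp : hsSq (S * (1 - P)) ≤ hsSq ((1 - S) * P) := by
    rw [hS.hsSq_mul_eq, hS.compl.hsSq_mul_eq, hP.symm, hP.idem, hP.compl.symm, hP.compl.idem,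
      Matrix.mul_sub, Matrix.sub_mul, Matrix.trace_sub, Matrix.trace_sub, Matrix.mul_one,
      Matrix.one_mul]
    linarith
  have hsplit : S * A = S * (P * A) + S * (1 - P) * ((1 - P) * A) := by
    rw [← Matrix.mul_assoc (S * (1 - P)), Matrix.mul_assoc S, hP.compl.idem, Matrix.mul_assoc S,
      ← Matrix.mul_add, ← Matrix.add_mul]
    simp
  have hsum := hsSq_add (S * (P * A)) (S * (1 - P) * ((1 - P) * A))
  rw [← hsplit] at hsum
  have hlast : hsSq (S * (1 - P) * ((1 - P) * A)) ≤ hsSq (S * (1 - P)) * z ^ 2 :=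
    (hsSq_mul_le' _ _).trans (mul_le_mul_of_nonneg_left
      (pow_le_pow_left₀ (norm_nonneg _) hz 2) (hsSq_nonneg _))
  -- By cyclicity and idempotence of `S`, the cross term only sees the off-diagonal block of `A *
  -- Aᵀ`, which `κ` bounds.
  have hcross : (S * (P * A) * (S * (1 - P) * ((1 - P) * A))ᵀ).trace
      = (P * (A * Aᵀ) * (1 - P) * (S * (1 - P))ᵀ).trace := by
    have e1 : (S * (P * A) * (S * (1 - P) * ((1 - P) * A))ᵀ).trace
        = (S * (P * (A * Aᵀ) * ((1 - P) * ((1 - P) * S)))).trace := by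
      simp only [Matrix.transpose_mul, hS.symm, hP.compl.symm, Matrix.mul_assoc]
    have e2 : (P * (A * Aᵀ) * (1 - P) * (S * (1 - P))ᵀ)
        = P * (A * Aᵀ) * ((1 - P) * ((1 - P) * S)) := by
      simp only [Matrix.transpose_mul, hS.symm, hP.compl.symm, Matrix.mul_assoc]
    rw [e1, e2, Matrix.trace_mul_comm]
    simp only [Matrix.mul_assoc, hS.idem]
  have hcs := sq_trace_mul_transpose_le (P * (A * Aᵀ) * (1 - P)) (S * (1 - P))
  rw [← hcross] at hcs
  set c := (S * (P * A) * (S * (1 - P) * ((1 - P) * A))ᵀ).trace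
  set q := hsSq ((1 - S) * P)
  set p := hsSq (S * (1 - P))
  have hp0 : 0 ≤ p := hsSq_nonneg _
  have hq0 : 0 ≤ q := hp0.trans hp
  have hc2 : c ^ 2 ≤ q * κ := by
    rw [mul_comm]
    exact hcs.trans (mul_le_mul hκ hp (hsSq_nonneg _) hκ0)
  have hjj : 0 < j ^ 2 := by positivity
  -- AM-GM, weighted so that the cross term uses half of the loss `q / j ^ 2`; the trailing part
  -- uses another quarter (`hz2`), so only the `κ` term survives.
  have hc : 2 * c ≤ q / (2 * j ^ 2) + 2 * j ^ 2 * κ := by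
    refine le_of_abs_le (abs_le_of_sq_le_sq ?_ (by positivity))
    have : (q / (2 * j ^ 2) + 2 * j ^ 2 * κ) ^ 2
        = (q / (2 * j ^ 2) - 2 * j ^ 2 * κ) ^ 2 + 4 * (q * κ) := by
      field_simp; ring
    rw [this]
    nlinarith [sq_nonneg (q / (2 * j ^ 2) - 2 * j ^ 2 * κ)]
  have hq' : q / j ^ 2 ≤ hsSq ((1 - S) * (P * A)) := by
    rw [div_le_iff₀ hjj]; exact hq
  have hz2 : p * z ^ 2 ≤ q / (4 * j ^ 2) := by
    rw [le_div_iff₀ (by positivity)]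
    have : (j * z) ^ 2 ≤ (1 / 2) ^ 2 := pow_le_pow_left₀ (by positivity) hjz 2
    nlinarith
  have e1 : q / (2 * j ^ 2) = q / j ^ 2 / 2 := by field_simp
  have e2 : q / (4 * j ^ 2) = q / j ^ 2 / 4 := by field_simp
  have h0 : 0 ≤ q / j ^ 2 := by positivity
  rw [e1] at hc
  rw [e2] at hz2
  linarith

/-- `E` is the orthogonal projection onto the graph `{x + G x}` over the range of `P`, where `G`
maps the range of `P` to its orthogonal complement. -/
structure IsGraphProj {m : ℕ} (P G E : Matrix (Fin m) (Fin m) ℝ) : Prop where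
  base : IsOrthProj P
  proj : IsOrthProj E
  left_zero : P * G = 0
  right_self : G * P = G
  mem : (P + G) * E = E
  fix : E * (P + G) = P + G

/-- The hypotheses force `G * G = 0`, so `P + G` is idempotent: it is an oblique projection onto the
graph, and `E` is the orthogonal one with the same range. -/
theorem exists_isGraphProj {m : ℕ} {P G : Matrix (Fin m) (Fin m) ℝ} (hP : IsOrthProj P)
    (h0 : P * G = 0) (h1 : G * P = G) : ∃ E, IsGraphProj P G E := by
  refine ⟨colProj (P + G), hP, isOrthProj_colProj _, h0, h1, ?_, colProj_mul_self _⟩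
  obtain ⟨Y, hY⟩ := colProj_mem (P + G)
  have h2 : G * G = 0 := by
    rw [← h1, Matrix.mul_assoc, ← Matrix.mul_assoc P, h0]; simp
  have : (P + G) * (P + G) = P + G := by
    rw [Matrix.add_mul, Matrix.mul_add, Matrix.mul_add, hP.idem, h0, h1, h2]; simp
  rw [hY, ← Matrix.mul_assoc, this]

namespace IsGraphProj

variable {m : ℕ} {P G E : Matrix (Fin m) (Fin m) ℝ}

theorem trace_eq (h : IsGraphProj P G E) : E.trace = P.trace := by
  rw [← h.mem, Matrix.trace_mul_comm, h.fix, Matrix.trace_add, ← h.right_self,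
    Matrix.trace_mul_comm G, h.left_zero]
  simp

theorem compl_base_mul (h : IsGraphProj P G E) : (1 - P) * E = G * E := by
  conv_lhs => rw [← h.mem]
  rw [← Matrix.mul_assoc, Matrix.mul_add, h.base.compl_mul, Matrix.sub_mul, h.left_zero]
  simp

theorem mul_compl_base (h : IsGraphProj P G E) : E * (1 - P) = E * Gᵀ := by
  have := congrArg Matrix.transpose h.compl_base_mul
  simpa only [Matrix.transpose_mul, h.proj.symm, h.base.compl.symm] using this

theorem compl_mul_fix (h : IsGraphProj P G E) : (1 - E) * (P + G) = 0 := by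
  rw [Matrix.sub_mul, h.fix]; simp

theorem compl_eq (h : IsGraphProj P G E) : 1 - E = (1 - E) * (1 - P - G) := by
  have : (1 - P - G) = 1 - (P + G) := by abel
  rw [this, Matrix.mul_sub, h.compl_mul_fix]; simp

theorem compl_mul_base (h : IsGraphProj P G E) : (1 - E) * P = -((1 - E) * G) := by
  rw [eq_neg_iff_add_eq_zero, ← Matrix.mul_add, h.compl_mul_fix]

theorem norm_mul_compl_base_le (h : IsGraphProj P G E) : ‖E * (1 - P)‖ ≤ ‖G‖ := by
  rw [h.mul_compl_base]
  simpa [norm_transpose_l2] using norm_mul_le_of_le_l2 h.proj.norm_le_one (le_refl ‖Gᵀ‖)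

theorem norm_compl_base_mul_le (h : IsGraphProj P G E) : ‖(1 - P) * E‖ ≤ ‖G‖ := by
  rw [h.compl_base_mul]
  simpa using norm_mul_le_of_le_l2 (le_refl ‖G‖) h.proj.norm_le_one

/-- The difference is exactly `(1 - E) * G * Gᵀ`, so the tilt is linear in the slope up to a
quadratic error. This precision is needed for the second-order residual. -/
theorem norm_mul_compl_base_sub_le (h : IsGraphProj P G E) :
    ‖E * (1 - P) - Gᵀ‖ ≤ ‖G‖ ^ 2 := by
  have hG : Gᵀ = P * Gᵀ := by
    have := congrArg Matrix.transpose h.right_self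
    rw [Matrix.transpose_mul, h.base.symm] at this
    exact this.symm
  have : E * (1 - P) - Gᵀ = (1 - E) * G * Gᵀ := by
    have h2 : (1 - E) * Gᵀ = -((1 - E) * G * Gᵀ) := by
      conv_lhs => rw [hG, ← Matrix.mul_assoc, h.compl_mul_base]
      rw [Matrix.neg_mul]
    rw [← neg_eq_iff_eq_neg] at h2
    rw [← h2, h.mul_compl_base, Matrix.sub_mul]
    simp
  rw [this, sq]
  refine norm_mul_le_of_le_l2 ?_ (norm_transpose_l2 G).le
  simpa using norm_mul_le_of_le_l2 h.proj.compl.norm_le_one (le_refl ‖G‖)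

theorem norm_sub_le (h : IsGraphProj P G E) : ‖E - P‖ ≤ 2 * ‖G‖ := by
  have : E - P = E * (1 - P) - (1 - E) * P := by noncomm_ring
  rw [this, h.compl_mul_base, sub_neg_eq_add, two_mul]
  refine (norm_add_le _ _).trans (add_le_add h.norm_mul_compl_base_le ?_)
  simpa using norm_mul_le_of_le_l2 h.proj.compl.norm_le_one (le_refl ‖G‖)

end IsGraphProj

theorem exists_mul_inverse_of_norm_le_half {m : ℕ} {X : Matrix (Fin m) (Fin m) ℝ}
    (hX : ‖X‖ ≤ 1 / 2) : ∃ V, (1 - X) * V = 1 ∧ V * (1 - X) = 1 ∧ ‖V‖ ≤ 2 := by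
  obtain ⟨u, hu⟩ := isUnit_one_sub_of_norm_lt_one (lt_of_le_of_lt hX (by norm_num))
  refine ⟨↑u⁻¹, by rw [← hu]; simp, by rw [← hu]; simp, ?_⟩
  have h1 : (↑u⁻¹ : Matrix (Fin m) (Fin m) ℝ) = 1 + X * (↑u⁻¹ : Matrix (Fin m) (Fin m) ℝ) := by
    have : (1 - X) * (↑u⁻¹ : Matrix (Fin m) (Fin m) ℝ) = 1 := by rw [← hu]; simp
    rw [Matrix.sub_mul, Matrix.one_mul] at this
    rw [← this]; abel
  have h2 : ‖(1 : Matrix (Fin m) (Fin m) ℝ)‖ ≤ 1 :=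
    IsOrthProj.norm_le_one ⟨Matrix.transpose_one, Matrix.one_mul _⟩
  have h3 := norm_add_le (1 : Matrix (Fin m) (Fin m) ℝ) (X * (↑u⁻¹ : Matrix (Fin m) (Fin m) ℝ))
  rw [← h1] at h3
  have h4 := norm_mul_le_of_le_l2 hX (le_refl ‖(↑u⁻¹ : Matrix (Fin m) (Fin m) ℝ)‖)
  linarith

/-- `Y` is an approximate inverse of the leading block. Neumann inverses correct it on the right and
on the left, and the two results coincide, as one-sided inverses do. -/
theorem exists_block_inverse {m n : ℕ} {A : Matrix (Fin m) (Fin n) ℝ}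
    {P : Matrix (Fin m) (Fin m) ℝ} {Q : Matrix (Fin n) (Fin n) ℝ} (hP : IsOrthProj P)
    (hQ : IsOrthProj Q) (Y : Matrix (Fin n) (Fin m) ℝ)
    (h1 : ‖P - P * A * Q * Y * P‖ ≤ 1 / 2) (h2 : ‖Q - Q * Y * P * A * Q‖ ≤ 1 / 2) :
    ∃ J : Matrix (Fin n) (Fin m) ℝ, J * P = J ∧ Q * J = J ∧ P * A * J = P ∧ J * A * Q = Q ∧
      ‖J‖ ≤ 2 * ‖Y‖ := by
  obtain ⟨V, hV, -, hVn⟩ := exists_mul_inverse_of_norm_le_half h1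
  obtain ⟨V', -, hV', -⟩ := exists_mul_inverse_of_norm_le_half h2
  have e1 : P * A * Q * Y * P = P * (1 - (P - P * A * Q * Y * P)) := by
    rw [Matrix.mul_sub, Matrix.mul_sub, hP.idem]
    simp only [← Matrix.mul_assoc, hP.idem]
    simp
  have e2 : Q * Y * P * A * Q = (1 - (Q - Q * Y * P * A * Q)) * Q := by
    rw [Matrix.sub_mul, Matrix.sub_mul, hQ.idem]
    simp only [Matrix.mul_assoc, hQ.idem]
    simp
  have r1 : P * A * (Q * Y * P * V) = P := by
    calc P * A * (Q * Y * P * V) = P * A * Q * Y * P * V := by simp only [Matrix.mul_assoc]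
      _ = P := by rw [e1, Matrix.mul_assoc, hV, Matrix.mul_one]
  have l1 : V' * Q * Y * P * A * Q = Q := by
    calc V' * Q * Y * P * A * Q = V' * (Q * Y * P * A * Q) := by simp only [Matrix.mul_assoc]
      _ = Q := by rw [e2, ← Matrix.mul_assoc, hV', Matrix.one_mul]
  have hJ : V' * Q * Y * P = Q * Y * P * V := by
    calc V' * Q * Y * P = V' * Q * Y * (P * A * (Q * Y * P * V)) := by rw [r1]
      _ = V' * Q * Y * P * A * Q * (Y * P * V) := by simp only [Matrix.mul_assoc]
      _ = Q * Y * P * V := by rw [l1]; simp only [Matrix.mul_assoc]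
  refine ⟨Q * Y * P * V, ?_, ?_, r1, ?_, ?_⟩
  · rw [← hJ, Matrix.mul_assoc, hP.idem]
  · simp only [← Matrix.mul_assoc, hQ.idem]
  · rw [← hJ, l1]
  · have := norm_mul_le_of_le_l2 (norm_mul_le_of_le_l2 (norm_mul_le_of_le_l2 hQ.norm_le_one
      (le_refl ‖Y‖)) hP.norm_le_one) hVn
    linarith

/-- The squared Hilbert-Schmidt distance of `A` to the matrices of rank at most `R`. -/
noncomputable def lowRankDist {m n : ℕ} (R : ℕ) (A : Matrix (Fin m) (Fin n) ℝ) : ℝ :=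
  ⨅ p : Matrix (Fin m) (Fin R) ℝ × Matrix (Fin n) (Fin R) ℝ, hsSq (A - p.1 * p.2ᵀ)

theorem lowRankDist_le {m n R : ℕ} (A : Matrix (Fin m) (Fin n) ℝ) (U : Matrix (Fin m) (Fin R) ℝ)
    (V : Matrix (Fin R) (Fin n) ℝ) : lowRankDist R A ≤ hsSq (A - U * V) := by
  have := ciInf_le (f := fun p : Matrix (Fin m) (Fin R) ℝ × Matrix (Fin n) (Fin R) ℝ =>
    hsSq (A - p.1 * p.2ᵀ)) ⟨0, by rintro _ ⟨p, rfl⟩; exact hsSq_nonneg _⟩ (U, Vᵀ)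
  rwa [Matrix.transpose_transpose] at this

/-- Projecting out the column space of the left factor kills the product and does not increase the
norm. -/
theorem le_lowRankDist {m n R : ℕ} (A : Matrix (Fin m) (Fin n) ℝ) {x : ℝ}
    (h : ∀ S : Matrix (Fin m) (Fin m) ℝ, IsOrthProj S → S.trace ≤ R →
      x ≤ hsSq ((1 - S) * A)) : x ≤ lowRankDist R A := by
  refine le_ciInf fun p => ?_
  have hS := isOrthProj_colProj p.1
  have hr : (p.1.rank : ℝ) ≤ R := by
    exact_mod_cast (Matrix.rank_le_width p.1)
  refine (h _ hS ((trace_colProj_le p.1).trans hr)).trans ?_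
  have : (1 - colProj p.1) * A = (1 - colProj p.1) * (A - p.1 * p.2ᵀ) := by
    rw [Matrix.mul_sub, ← Matrix.mul_assoc _ p.1, Matrix.sub_mul _ _ p.1, colProj_mul_self]
    simp
  rw [this]
  exact hS.compl.hsSq_mul_le_self _

end BlockPerturbation

/-! ### Low-rank distance of a nearly block-diagonal matrix -/

section BlockBound

open scoped Matrix.Norms.L2Operator

/-- If `A` has an invertible leading block with respect to the projections `P`, `Q`, whose inverse
`J` is small relative to the other blocks, then the squared distance of `A` to the matrices of rank
at most `R = rank P` is the squared norm of its trailing block, up to an error that is quadratic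
in the off-diagonal blocks. -/
theorem abs_lowRankDist_sub_le {m n R : ℕ} {A : Matrix (Fin m) (Fin n) ℝ}
    {P : Matrix (Fin m) (Fin m) ℝ} {Q : Matrix (Fin n) (Fin n) ℝ} {J : Matrix (Fin n) (Fin m) ℝ}
    (hP : IsOrthProj P) (hQ : IsOrthProj Q) (U : Matrix (Fin m) (Fin R) ℝ)
    (V : Matrix (Fin R) (Fin m) ℝ) (hUV : P = U * V) (htr : P.trace = R)
    (hJP : J * P = J) (hQJ : Q * J = J) (hPAJ : P * A * J = P) (hJAQ : J * A * Q = Q)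
    {j ε b : ℝ} (hj : 0 < j) (hJj : ‖J‖ ≤ j) (h21 : ‖(1 - P) * A * Q‖ ≤ ε)
    (h12 : ‖P * A * (1 - Q)‖ ≤ ε) (h22 : ‖(1 - P) * A * (1 - Q)‖ ≤ b)
    (hjε : j * ε ≤ 1 / 4) (hjb : j * b ≤ 1 / 4) :
    |lowRankDist R A - hsSq ((1 - P) * A * (1 - Q))| ≤ 4 * R * (j * ε ^ 2 * (b + ε)) := by
  have hε : 0 ≤ ε := (norm_nonneg _).trans h21
  have hb : 0 ≤ b := (norm_nonneg _).trans h22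
  have hR : (0 : ℝ) ≤ R := Nat.cast_nonneg R
  -- `Z` is the Schur complement of the leading block: it lives in the trailing block and differs
  -- from it by the low-rank `X`.
  set Z := A - A * J * A with hZdef
  set X := (1 - P) * A * Q * J * (P * A * (1 - Q)) with hXdef
  have hPZ : P * Z = 0 := by
    rw [hZdef, Matrix.mul_sub, ← Matrix.mul_assoc P (A * J), ← Matrix.mul_assoc P A, hPAJ, sub_self]
  have hZQ : Z * Q = 0 := by
    rw [hZdef, Matrix.sub_mul, Matrix.mul_assoc A J A, Matrix.mul_assoc A (J * A), hJAQ, sub_self]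
  have hZM : Z * (1 - Q) = Z := by rw [Matrix.mul_sub, hZQ, Matrix.mul_one, sub_zero]
  have hMZ : (1 - P) * Z = Z := by rw [Matrix.sub_mul, hPZ, Matrix.one_mul, sub_zero]
  have hX : X = (1 - P) * (A * J * A) * (1 - Q) := by
    calc X = (1 - P) * A * (Q * J * P) * A * (1 - Q) := by
          rw [hXdef]; simp only [Matrix.mul_assoc]
      _ = _ := by rw [hQJ, hJP]; simp only [Matrix.mul_assoc]
  have hZ : Z = (1 - P) * A * (1 - Q) - X := by
    rw [hX, ← Matrix.sub_mul, ← Matrix.mul_sub, ← hZdef, hMZ, hZM]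
  have hXn : ‖X‖ ≤ ε * j * ε := norm_mul_le_of_le_l2 (norm_mul_le_of_le_l2 h21 hJj) h12
  have hXrank : (X.rank : ℝ) ≤ R := by
    have h1 : X.rank ≤ U.rank := by
      have : X = (1 - P) * A * Q * J * (U * (V * A * (1 - Q))) := by
        rw [hXdef]; nth_rewrite 2 [hUV]; simp only [Matrix.mul_assoc]
      rw [this]
      exact (Matrix.rank_mul_le_right _ _).trans (Matrix.rank_mul_le_left _ _)
    exact_mod_cast h1.trans (Matrix.rank_le_width U)
  have hXZ : |((1 - P) * A * (1 - Q) * Xᵀ).trace| ≤ R * (ε * j * ε * b) := by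
    rw [trace_mul_transpose_comm]
    refine (abs_trace_mul_le_rank _ _).trans (mul_le_mul hXrank ?_ (by positivity) hR)
    rw [norm_transpose_l2]
    exact mul_le_mul hXn h22 (norm_nonneg _) (by positivity)
  have hXX : hsSq X ≤ R * (ε * j * ε * (ε * j * ε)) := by
    refine (le_abs_self _).trans ((abs_trace_mul_le_rank _ _).trans
      (mul_le_mul hXrank ?_ (by positivity) hR))
    rw [norm_transpose_l2]
    exact mul_le_mul hXn hXn (norm_nonneg _) (by positivity)
  have hZsq := hsSq_sub ((1 - P) * A * (1 - Q)) X
  rw [← hZ] at hZsq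
  have hZn : ‖Z‖ ≤ b + ε * j * ε := by
    rw [hZ]; exact (_root_.norm_sub_le _ _).trans (add_le_add h22 hXn)
  set z := b + ε * j * ε with hz
  have hz0 : 0 ≤ z := by positivity
  set x := hsSq ((1 - P) * A * (1 - Q))
  have hze : z ≤ b + ε / 4 := by
    have := mul_le_mul_of_nonneg_left hjε hε
    linarith
  have hjz : j * z ≤ 5 / 16 := by
    have := mul_le_mul_of_nonneg_left hze hj.le
    linarith
  have hu0 : 0 ≤ j * ε ^ 2 := by positivity
  have hXXb : ε * j * ε * (ε * j * ε) ≤ j * ε ^ 2 * (ε / 4) := by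
    have := mul_le_mul_of_nonneg_left hjε (mul_nonneg hu0 hε)
    linarith
  -- `A * J * A` factors through `U`, hence is a candidate of rank at most `R`.
  have hup : lowRankDist R A ≤ hsSq Z := by
    have := lowRankDist_le A (A * J * U) (V * A)
    have e : A * J * U * (V * A) = A * J * A := by
      calc A * J * U * (V * A) = A * (J * (U * V)) * A := by simp only [Matrix.mul_assoc]
        _ = A * J * A := by rw [← hUV, hJP]
    rwa [e] at this
  -- The range of `A * J` is the graph of `G`; its projection `E` is the nearly optimal competitor
  -- for the Ky Fan comparison.
  set G := (1 - P) * A * J with hGdef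
  have hPG : P + G = A * J := by
    rw [hGdef, Matrix.sub_mul, Matrix.sub_mul, Matrix.one_mul, hPAJ]; abel
  have hGn : ‖G‖ ≤ ε * j := by
    have : G = (1 - P) * A * Q * J := by
      rw [hGdef, Matrix.mul_assoc _ Q, hQJ]
    rw [this]; exact norm_mul_le_of_le_l2 h21 hJj
  obtain ⟨E, hE⟩ := exists_isGraphProj (P := P) (G := G) hP
    (by rw [hGdef, ← Matrix.mul_assoc, ← Matrix.mul_assoc, hP.mul_compl]; simp)
    (by rw [hGdef, Matrix.mul_assoc, hJP])
  have hEtr : E.trace = R := hE.trace_eq.trans htr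
  have hEZ : hsSq (E * Z) ≤ R * (ε * j * z) ^ 2 := by
    refine (hE.proj.hsSq_mul_le_trace Z).trans ?_
    rw [hEtr]
    refine mul_le_mul_of_nonneg_left (pow_le_pow_left₀ (norm_nonneg _) ?_ 2) hR
    rw [← hMZ, ← Matrix.mul_assoc]
    exact norm_mul_le_of_le_l2 (hE.norm_mul_compl_base_le.trans hGn) hZn
  have hEA : (1 - E) * A = (1 - E) * Z := by
    rw [hZdef, Matrix.mul_sub, ← hPG, ← Matrix.mul_assoc, hE.compl_mul_fix]; simp
  have hEAn : ‖(1 - E) * A‖ ≤ z := by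
    rw [hEA]
    simpa using norm_mul_le_of_le_l2 hE.proj.compl.norm_le_one hZn
  have hv : ‖E * (A * (1 - Q))‖ ≤ 5 / 4 * ε := by
    have : E * (A * (1 - Q)) = E * (P * A * (1 - Q)) + E * (1 - P) * ((1 - P) * A * (1 - Q)) := by
      have h : A = P * A + (1 - P) * ((1 - P) * A) := by
        rw [← Matrix.mul_assoc, hP.compl.idem, ← Matrix.add_mul]; simp
      conv_lhs => rw [h]
      simp only [Matrix.add_mul, Matrix.mul_add, Matrix.mul_assoc]
    rw [this]
    have h1 := norm_mul_le_of_le_l2 hE.proj.norm_le_one h12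
    have h2 := norm_mul_le_of_le_l2 (hE.norm_mul_compl_base_le.trans hGn) h22
    refine (norm_add_le _ _).trans ((add_le_add h1 h2).trans ?_)
    have := mul_le_mul_of_nonneg_left hjb hε
    linarith
  -- `(1 - E) * A` equals `(1 - E) * Z` and `Z` kills `Q`, so only the small factor `E * (A * (1 -
  -- Q))` meets it.
  have hκ : hsSq (E * (A * Aᵀ) * (1 - E)) ≤ R * (5 / 4 * ε) ^ 2 * z ^ 2 := by
    have : E * (A * Aᵀ) * (1 - E) = E * (A * (1 - Q)) * ((1 - E) * Z)ᵀ := by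
      calc E * (A * Aᵀ) * (1 - E) = E * A * ((1 - E) * A)ᵀ := by
            simp only [Matrix.transpose_mul, hE.proj.compl.symm, Matrix.mul_assoc]
        _ = E * A * ((1 - E) * (Z * (1 - Q)))ᵀ := by rw [hEA, hZM]
        _ = _ := by
            simp only [Matrix.transpose_mul, hQ.compl.symm, Matrix.mul_assoc]
    rw [this]
    refine (hsSq_mul_le' _ _).trans (mul_le_mul ?_ ?_ (by positivity) (by positivity))
    · refine (hE.proj.hsSq_mul_le_trace _).trans ?_
      rw [hEtr]
      exact mul_le_mul_of_nonneg_left (pow_le_pow_left₀ (norm_nonneg _) hv 2) hR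
    · rw [norm_transpose_l2, ← hEA]
      exact pow_le_pow_left₀ (norm_nonneg _) hEAn 2
  have hlow : hsSq Z - hsSq (E * Z) - 2 * j ^ 2 * (R * (5 / 4 * ε) ^ 2 * z ^ 2)
      ≤ lowRankDist R A := by
    refine le_lowRankDist A fun S hS hStr => ?_
    have hW : E * A * (J * E) = E := by
      rw [← Matrix.mul_assoc, Matrix.mul_assoc E A, ← hPG, hE.fix, hE.mem]
    have hWn : ‖J * E‖ ≤ j := by
      simpa using norm_mul_le_of_le_l2 hJj hE.proj.norm_le_one
    have h := hsSq_proj_mul_le hE.proj hS (hStr.trans hEtr.ge) (J * E) hW hj hWn hEAn hκ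
      (by linarith)
    have s1 := hS.hsSq_split A
    have s2 := hE.proj.hsSq_split A
    have s3 := hE.proj.hsSq_split Z
    rw [hEA] at s2
    linarith
  have hEZb : (ε * j * z) ^ 2 ≤ j * ε ^ 2 * (b + ε) * (5 / 16) := by
    have : (ε * j * z) ^ 2 = j * ε ^ 2 * z * (j * z) := by ring
    rw [this]
    exact mul_le_mul (mul_le_mul_of_nonneg_left (by linarith) hu0) hjz (by positivity)
      (by positivity)
  have hκb : 2 * j ^ 2 * ((5 / 4 * ε) ^ 2 * z ^ 2) ≤ j * ε ^ 2 * (b + ε) := by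
    have : 2 * j ^ 2 * ((5 / 4 * ε) ^ 2 * z ^ 2) = 25 / 8 * (ε * j * z) ^ 2 := by ring
    rw [this]
    have : 0 ≤ j * ε ^ 2 * (b + ε) := by positivity
    linarith
  have hEZc := mul_le_mul_of_nonneg_left hEZb hR
  have hκc := mul_le_mul_of_nonneg_left hκb hR
  have hXXc := mul_le_mul_of_nonneg_left hXXb hR
  have hpos1 : 0 ≤ R * (j * ε ^ 2 * b) := by positivity
  have hpos2 : 0 ≤ R * (j * ε ^ 2 * ε) := by positivity
  have hXX0 : 0 ≤ hsSq X := hsSq_nonneg X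
  obtain ⟨hc1, hc2⟩ := abs_le.1 hXZ
  have e1 : R * (ε * j * ε * b) = R * (j * ε ^ 2 * b) := by ring
  rw [e1] at hc1 hc2
  rw [abs_le]
  constructor <;> linarith
end BlockBound

/-! ### Tilted factor spaces and the residual to second order in the error -/

section FactorSpaces

open scoped Matrix.Norms.L2Operator

/-- `L` is the Moore-Penrose inverse of `Λ`, with `P`, `Q` the projections onto the column space
and the row space of `Λ`. -/
structure IsMoorePenrose {m n : ℕ} (P : Matrix (Fin m) (Fin m) ℝ) (Q : Matrix (Fin n) (Fin n) ℝ)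
    (Λ : Matrix (Fin m) (Fin n) ℝ) (L : Matrix (Fin n) (Fin m) ℝ) : Prop where
  left : IsOrthProj P
  right : IsOrthProj Q
  left_mul : P * Λ = Λ
  mul_right : Λ * Q = Λ
  mul_inv : Λ * L = P
  inv_mul : L * Λ = Q
  right_inv : Q * L = L
  inv_left : L * P = L

theorem IsMoorePenrose.transpose {m n : ℕ} {P : Matrix (Fin m) (Fin m) ℝ}
    {Q : Matrix (Fin n) (Fin n) ℝ} {Λ : Matrix (Fin m) (Fin n) ℝ} {L : Matrix (Fin n) (Fin m) ℝ}
    (h : IsMoorePenrose P Q Λ L) : IsMoorePenrose Q P Λᵀ Lᵀ where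
  left := h.right
  right := h.left
  left_mul := by rw [← h.right.symm, ← Matrix.transpose_mul, h.mul_right]
  mul_right := by rw [← h.left.symm, ← Matrix.transpose_mul, h.left_mul]
  mul_inv := by rw [← Matrix.transpose_mul, h.inv_mul, h.right.symm]
  inv_mul := by rw [← Matrix.transpose_mul, h.mul_inv, h.left.symm]
  right_inv := by rw [← h.left.symm, ← Matrix.transpose_mul, h.inv_left]
  inv_left := by rw [← h.right.symm, ← Matrix.transpose_mul, h.right_inv]

/-- The second order approximation in `e` of the slope of the perturbed column space. -/
noncomputable def graphSlope {m n : ℕ} (P : Matrix (Fin m) (Fin m) ℝ)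
    (Q : Matrix (Fin n) (Fin n) ℝ) (L : Matrix (Fin n) (Fin m) ℝ) (e : Matrix (Fin m) (Fin n) ℝ) :
    Matrix (Fin m) (Fin m) ℝ :=
  (1 - P) * e * L + ((1 - P) * e * ((1 - Q) * eᵀ * Lᵀ) - (1 - P) * e * L * e * Q) * L

/-- The part of the projected residual `M_λ̂ Y M_f̂` that is quadratic in the error `e`, up to sign. -/
noncomputable def secondOrderTerm {m n : ℕ} (P : Matrix (Fin m) (Fin m) ℝ)
    (Q : Matrix (Fin n) (Fin n) ℝ) (L : Matrix (Fin n) (Fin m) ℝ) (e : Matrix (Fin m) (Fin n) ℝ) :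
    Matrix (Fin m) (Fin n) ℝ :=
  (1 - P) * e * L * (e * (1 - Q)) + ((1 - P) * e * L)ᵀ * ((1 - P) * e * (1 - Q))
    + (1 - P) * e * (1 - Q) * ((1 - Q) * eᵀ * Lᵀ)

namespace IsMoorePenrose

variable {m n : ℕ} {P : Matrix (Fin m) (Fin m) ℝ}
    {Q : Matrix (Fin n) (Fin n) ℝ} {Λ : Matrix (Fin m) (Fin n) ℝ} {L : Matrix (Fin n) (Fin m) ℝ}

theorem left_mul_graphSlope (h : IsMoorePenrose P Q Λ L) (e : Matrix (Fin m) (Fin n) ℝ) :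
    P * graphSlope P Q L e = 0 := by
  have : ∀ {p : ℕ} (A : Matrix (Fin m) (Fin p) ℝ), P * ((1 - P) * A) = 0 := by
    intro p A
    rw [← Matrix.mul_assoc, h.left.mul_compl, Matrix.zero_mul]
  simp only [graphSlope, Matrix.mul_assoc, ← Matrix.mul_sub (1 - P), ← Matrix.mul_add (1 - P),
    Matrix.sub_mul _ _ L, this]

theorem graphSlope_mul_left (h : IsMoorePenrose P Q Λ L) (e : Matrix (Fin m) (Fin n) ℝ) :
    graphSlope P Q L e * P = graphSlope P Q L e := by
  rw [graphSlope, Matrix.add_mul, Matrix.mul_assoc _ L, Matrix.mul_assoc _ L, h.inv_left]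

theorem graphSlope_mul (h : IsMoorePenrose P Q Λ L) (e : Matrix (Fin m) (Fin n) ℝ) :
    graphSlope P Q L e * Λ
      = (1 - P) * e * Q + ((1 - P) * e * ((1 - Q) * eᵀ * Lᵀ) - (1 - P) * e * L * e * Q) := by
  rw [graphSlope, Matrix.add_mul, Matrix.mul_assoc _ L, Matrix.mul_assoc _ L, h.inv_mul,
    Matrix.sub_mul _ _ Q]
  congr 2
  · rw [Matrix.mul_assoc _ _ Q, Matrix.mul_assoc _ Lᵀ, h.transpose.inv_left]
  · rw [Matrix.mul_assoc _ Q, h.right.idem]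

theorem norm_first_le (h : IsMoorePenrose P Q Λ L) {e : Matrix (Fin m) (Fin n) ℝ} {l a : ℝ}
    (hL : ‖L‖ ≤ l) (he : ‖e‖ ≤ a) : ‖(1 - P) * e * L‖ ≤ l * a := by
  have := norm_mul_le_of_le_l2 (norm_mul_le_of_le_l2 h.left.compl.norm_le_one he) hL
  linarith

theorem norm_graphSlope_sub_le (h : IsMoorePenrose P Q Λ L) {e : Matrix (Fin m) (Fin n) ℝ}
    {l a : ℝ} (hL : ‖L‖ ≤ l) (he : ‖e‖ ≤ a) :
    ‖graphSlope P Q L e - (1 - P) * e * L‖ ≤ 2 * (l * a) ^ 2 := by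
  have het : ‖eᵀ‖ ≤ a := by rwa [norm_transpose_l2]
  have hLt : ‖Lᵀ‖ ≤ l := by rwa [norm_transpose_l2]
  have h1 := norm_mul_le_of_le_l2 (norm_mul_le_of_le_l2 h.left.compl.norm_le_one he)
    (h.transpose.norm_first_le hLt het)
  have h2 := norm_mul_le_of_le_l2 (norm_mul_le_of_le_l2 (h.norm_first_le hL he) he)
    h.right.norm_le_one
  have h3 := norm_mul_le_of_le_l2 ((norm_sub_le _ _).trans (add_le_add h1 h2)) hL
  rw [graphSlope, add_sub_cancel_left]
  linarith

theorem norm_graphSlope_le (h : IsMoorePenrose P Q Λ L) {e : Matrix (Fin m) (Fin n) ℝ}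
    {l a : ℝ} (hL : ‖L‖ ≤ l) (he : ‖e‖ ≤ a) (hla : l * a ≤ 1 / 100) :
    ‖graphSlope P Q L e‖ ≤ 2 * (l * a) := by
  have h0 : 0 ≤ l * a := mul_nonneg ((norm_nonneg _).trans hL) ((norm_nonneg _).trans he)
  have h1 := norm_add_le (graphSlope P Q L e - (1 - P) * e * L) ((1 - P) * e * L)
  rw [sub_add_cancel] at h1
  have h2 := h.norm_graphSlope_sub_le hL he
  have h3 := h.norm_first_le hL he
  nlinarith

/-- The perturbed column and row spaces nearly block-diagonalize `Λ + e`. -/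
theorem norm_off_diagonal_le (h : IsMoorePenrose P Q Λ L) {e : Matrix (Fin m) (Fin n) ℝ}
    {l a : ℝ} (hL : ‖L‖ ≤ l) (he : ‖e‖ ≤ a) (hla : l * a ≤ 1 / 100)
    {E : Matrix (Fin m) (Fin m) ℝ} {F : Matrix (Fin n) (Fin n) ℝ}
    (hE : IsGraphProj P (graphSlope P Q L e) E) (hF : IsGraphProj Q (graphSlope Q P Lᵀ eᵀ) F) :
    ‖(1 - E) * (Λ + e) * F‖ ≤ 8 * (l * a) ^ 2 * a := by
  have het : ‖eᵀ‖ ≤ a := by rwa [norm_transpose_l2]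
  have hLt : ‖Lᵀ‖ ≤ l := by rwa [norm_transpose_l2]
  have ha : 0 ≤ a := (norm_nonneg _).trans he
  have hGL := h.graphSlope_mul e
  have hG2 := h.norm_graphSlope_sub_le hL he
  have hG := h.norm_graphSlope_le hL he hla
  have hH2 := h.transpose.norm_graphSlope_sub_le hLt het
  have hH := h.transpose.norm_graphSlope_le hLt het hla
  set G := graphSlope P Q L e
  set H := graphSlope Q P Lᵀ eᵀ
  have hΛH : Λ * H = 0 := by
    rw [← h.mul_right, Matrix.mul_assoc, hF.left_zero]; simp
  have hMΛ : (1 - P) * Λ = 0 := by rw [Matrix.sub_mul, h.left_mul]; simp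
  -- `G * Λ` (see `graphSlope_mul`) is chosen to cancel the first-order block `(1 - P) * e * Q` and
  -- all second-order terms; what is left is at least cubic in `e`.
  have key : (1 - P - G) * (Λ + e) * (Q + H)
      = (1 - P) * e * (H - (1 - Q) * eᵀ * Lᵀ) - (G - (1 - P) * e * L) * e * Q - G * e * H := by
    have e1 : (1 - P - G) * Λ * (Q + H) = -(G * Λ) := by
      rw [Matrix.mul_assoc, Matrix.mul_add, h.mul_right, hΛH, add_zero, Matrix.sub_mul, hMΛ,
        zero_sub]
    rw [Matrix.mul_add _ Λ e, Matrix.add_mul, e1, hGL]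
    simp only [Matrix.mul_add, Matrix.mul_sub, Matrix.sub_mul, Matrix.one_mul, Matrix.mul_assoc]
    abel
  have hEF : (1 - E) * (Λ + e) * F = (1 - E) * ((1 - P - G) * (Λ + e) * (Q + H)) * F := by
    conv_lhs => rw [hE.compl_eq, ← hF.mem]
    simp only [Matrix.mul_assoc]
  have b1 := norm_mul_le_of_le_l2 (norm_mul_le_of_le_l2 h.left.compl.norm_le_one he) hH2
  have b2 := norm_mul_le_of_le_l2 (norm_mul_le_of_le_l2 hG2 he) h.right.norm_le_one
  have b3 := norm_mul_le_of_le_l2 (norm_mul_le_of_le_l2 hG he) hH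
  have b4 := (norm_sub_le _ _).trans (add_le_add ((norm_sub_le _ _).trans (add_le_add b1 b2)) b3)
  rw [← key] at b4
  have b5 := norm_mul_le_of_le_l2 (norm_mul_le_of_le_l2 hE.proj.compl.norm_le_one b4)
    hF.proj.norm_le_one
  rw [← hEF] at b5
  linarith

/-- The residual of `Λ + e` after projecting out the perturbed column and row spaces, to second
order in `e`. -/
theorem norm_residual_sub_le (h : IsMoorePenrose P Q Λ L) {e : Matrix (Fin m) (Fin n) ℝ}
    {l a : ℝ} (hL : ‖L‖ ≤ l) (he : ‖e‖ ≤ a) (hla : l * a ≤ 1 / 100)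
    {E : Matrix (Fin m) (Fin m) ℝ} {F : Matrix (Fin n) (Fin n) ℝ}
    (hE : IsGraphProj P (graphSlope P Q L e) E) (hF : IsGraphProj Q (graphSlope Q P Lᵀ eᵀ) F) :
    ‖(1 - E) * (Λ + e) * (1 - F)‖ ≤ 2 * a ∧
    ‖(1 - E) * (Λ + e) * (1 - F) - ((1 - P) * e * (1 - Q) - secondOrderTerm P Q L e)‖
      ≤ 50 * (l * a) ^ 2 * a := by
  have het : ‖eᵀ‖ ≤ a := by rwa [norm_transpose_l2]
  have hLt : ‖Lᵀ‖ ≤ l := by rwa [norm_transpose_l2]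
  have ha : 0 ≤ a := (norm_nonneg _).trans he
  have hη0 : 0 ≤ l * a := mul_nonneg ((norm_nonneg _).trans hL) ha
  have hGL := h.graphSlope_mul e
  have hG1 := h.norm_first_le hL he
  have hG2 := h.norm_graphSlope_sub_le hL he
  have hG := h.norm_graphSlope_le hL he hla
  have hH1 := h.transpose.norm_first_le hLt het
  have hH2 := h.transpose.norm_graphSlope_sub_le hLt het
  have hH := h.transpose.norm_graphSlope_le hLt het hla
  rw [secondOrderTerm]
  set G := graphSlope P Q L e with hGdef
  set H := graphSlope Q P Lᵀ eᵀ with hHdef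
  set G1 := (1 - P) * e * L with hG1def
  set H1 := (1 - Q) * eᵀ * Lᵀ with hH1def
  set B := (1 - P) * e * (1 - Q) with hBdef
  set η := l * a with hη
  have hHt : ‖Hᵀ‖ ≤ 2 * η := by rwa [norm_transpose_l2]
  have hG1t : ‖G1ᵀ‖ ≤ η := by rwa [norm_transpose_l2]
  have hMΛ : (1 - P) * Λ = 0 := by rw [Matrix.sub_mul, h.left_mul]; simp
  have hΛM : Λ * (1 - Q) = 0 := by rw [Matrix.mul_sub, h.mul_right]; simp
  have hQH : Q * Hᵀ = Hᵀ := by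
    have := congrArg Matrix.transpose hF.right_self
    rwa [Matrix.transpose_mul, h.right.symm] at this
  have hMG : (1 - P) * G = G := by rw [Matrix.sub_mul, hE.left_zero]; simp
  have hHM : Hᵀ * (1 - Q) = Hᵀ := by
    have : H = (1 - Q) * H := by rw [Matrix.sub_mul, hF.left_zero]; simp
    have := congrArg Matrix.transpose this
    rw [Matrix.transpose_mul, h.right.compl.symm] at this
    exact this.symm
  have hFc : 1 - F = (1 - Q - Hᵀ) * (1 - F) := by
    have := congrArg Matrix.transpose hF.compl_eq
    rwa [Matrix.transpose_mul, hF.proj.compl.symm, Matrix.transpose_sub, h.right.compl.symm] at this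
  -- The trailing parenthesis, later `S`, collects everything of third order or higher in `e`.
  set Z := B - G1 * (e * (1 - Q)) + (-((G - G1) * (e * (1 - Q)))
    + (((1 - P) * e * H1 - G1 * e * Q) * Hᵀ + G * e * Hᵀ)) with hZdef
  have hZ : (1 - P - G) * (Λ + e) * (1 - Q - Hᵀ) = Z := by
    have e1 : (1 - P - G) * Λ * (1 - Q - Hᵀ)
        = (1 - P) * e * Hᵀ + ((1 - P) * e * H1 - G1 * e * Q) * Hᵀ := by
      rw [Matrix.mul_assoc, Matrix.mul_sub _ _ Hᵀ, hΛM, zero_sub, Matrix.mul_neg,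
        ← Matrix.mul_assoc, Matrix.sub_mul _ G, hMΛ, zero_sub, Matrix.neg_mul, neg_neg, hGL,
        Matrix.add_mul, Matrix.mul_assoc _ Q, hQH]
    rw [Matrix.mul_add _ Λ e, Matrix.add_mul, e1, hZdef, hBdef]
    simp only [Matrix.mul_sub, Matrix.sub_mul, Matrix.mul_one, Matrix.one_mul, Matrix.mul_assoc]
    abel
  have hMZ : (1 - P) * Z = Z := by
    rw [← hZ, ← Matrix.mul_assoc, ← Matrix.mul_assoc, Matrix.mul_sub _ _ G, h.left.compl.idem, hMG]
  have hZM : Z * (1 - Q) = Z := by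
    rw [← hZ, Matrix.mul_assoc _ _ (1 - Q), Matrix.sub_mul _ Hᵀ, h.right.compl.idem, hHM]
  have hR : (1 - E) * (Λ + e) * (1 - F) = (1 - E) * Z * (1 - F) := by
    conv_lhs => rw [hE.compl_eq, hFc]
    rw [← hZ]
    simp only [Matrix.mul_assoc]
  have hB : ‖B‖ ≤ a := by
    have := norm_mul_le_of_le_l2 (norm_mul_le_of_le_l2 h.left.compl.norm_le_one he)
      h.right.compl.norm_le_one
    linarith
  have heM : ‖e * (1 - Q)‖ ≤ a := by
    simpa using norm_mul_le_of_le_l2 he h.right.compl.norm_le_one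
  set S := -((G - G1) * (e * (1 - Q))) + (((1 - P) * e * H1 - G1 * e * Q) * Hᵀ + G * e * Hᵀ)
    with hSdef
  have hS : ‖S‖ ≤ 10 * η ^ 2 * a := by
    have b1 := norm_mul_le_of_le_l2 hG2 heM
    rw [← norm_neg] at b1
    have b2 := norm_mul_le_of_le_l2 (norm_mul_le_of_le_l2 h.left.compl.norm_le_one he) hH1
    have b3 := norm_mul_le_of_le_l2 (norm_mul_le_of_le_l2 hG1 he) h.right.norm_le_one
    have b4 := norm_mul_le_of_le_l2 ((norm_sub_le _ _).trans (add_le_add b2 b3)) hHt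
    have b5 := norm_mul_le_of_le_l2 (norm_mul_le_of_le_l2 hG he) hHt
    have b6 := (norm_add_le _ _).trans (add_le_add b1 ((norm_add_le _ _).trans (add_le_add b4 b5)))
    rw [← hSdef] at b6
    linarith
  have hηa : 0 ≤ η * a := mul_nonneg hη0 ha
  have hηηa : η ^ 2 * a ≤ 1 / 100 * (η * a) := by nlinarith
  have hηa' : η * a ≤ 1 / 100 * a := mul_le_mul_of_nonneg_right hla ha
  have hZB : ‖Z - B‖ ≤ 2 * η * a := by
    have : Z - B = S - G1 * (e * (1 - Q)) := by rw [hZdef]; abel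
    rw [this]
    have b1 := (norm_sub_le _ _).trans (add_le_add hS (norm_mul_le_of_le_l2 hG1 heM))
    linarith
  have hZn : ‖Z‖ ≤ 2 * a := by
    have := norm_add_le (Z - B) B
    rw [sub_add_cancel] at this
    linarith
  refine ⟨?_, ?_⟩
  · rw [hR]
    have := norm_mul_le_of_le_l2 (norm_mul_le_of_le_l2 hE.proj.compl.norm_le_one hZn)
      hF.proj.compl.norm_le_one
    linarith
  have hEG : ‖E * (1 - P) - G1ᵀ‖ ≤ 6 * η ^ 2 := by
    have b1 := hE.norm_mul_compl_base_sub_le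
    have b2 : ‖(G - G1)ᵀ‖ ≤ 2 * η ^ 2 := by rwa [norm_transpose_l2]
    have b3 := norm_add_le (E * (1 - P) - Gᵀ) (G - G1)ᵀ
    have e3 : E * (1 - P) - Gᵀ + (G - G1)ᵀ = E * (1 - P) - G1ᵀ := by
      rw [Matrix.transpose_sub]; abel
    rw [e3] at b3
    have b4 : ‖G‖ ^ 2 ≤ (2 * η) ^ 2 := pow_le_pow_left₀ (norm_nonneg _) hG 2
    linarith
  have hFH : ‖(1 - Q) * F - H1‖ ≤ 6 * η ^ 2 := by
    have b1 := hF.norm_mul_compl_base_sub_le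
    rw [← norm_transpose_l2, Matrix.transpose_sub, Matrix.transpose_mul, hF.proj.symm,
      h.right.compl.symm, Matrix.transpose_transpose] at b1
    have b3 := norm_add_le ((1 - Q) * F - H) (H - H1)
    rw [sub_add_sub_cancel] at b3
    have b4 : ‖H‖ ^ 2 ≤ (2 * η) ^ 2 := pow_le_pow_left₀ (norm_nonneg _) hH 2
    linarith
  have hEM : ‖E * (1 - P)‖ ≤ 2 * η := hE.norm_mul_compl_base_le.trans hG
  have hMF : ‖(1 - Q) * F‖ ≤ 2 * η := hF.norm_compl_base_mul_le.trans hH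
  -- To leading order `E * (1 - P)`, `(1 - Q) * F` and `Z` are `G1ᵀ`, `H1` and `B`. Subtracting
  -- these approximations leaves products that are all cubic in `e`.
  have hdecomp : (1 - E) * Z * (1 - F) - (B - (G1 * (e * (1 - Q)) + G1ᵀ * B + B * H1))
      = S - ((E * (1 - P) - G1ᵀ) * Z + G1ᵀ * (Z - B))
        - (Z * ((1 - Q) * F - H1) + (Z - B) * H1) + E * (1 - P) * Z * ((1 - Q) * F) := by
    have e1 : E * (1 - P) * Z = E * Z := by rw [Matrix.mul_assoc, hMZ]
    have e2 : Z * ((1 - Q) * F) = Z * F := by rw [← Matrix.mul_assoc, hZM]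
    have e3 : S = Z - (B - G1 * (e * (1 - Q))) := by rw [hZdef]; abel
    have e4 : E * (1 - P) * Z * ((1 - Q) * F) = E * Z * F := by
      rw [e1, Matrix.mul_assoc, e2, ← Matrix.mul_assoc]
    rw [e4, Matrix.sub_mul (E * (1 - P)) _ Z, e1, Matrix.mul_sub Z _ H1, e2, e3]
    simp only [Matrix.mul_sub, Matrix.sub_mul, Matrix.mul_one, Matrix.one_mul, Matrix.mul_assoc]
    abel
  rw [hR, hdecomp]
  have b1 := norm_mul_le_of_le_l2 hEG hZn
  have b2 := norm_mul_le_of_le_l2 hG1t hZB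
  have b3 := norm_mul_le_of_le_l2 hZn hFH
  have b4 := norm_mul_le_of_le_l2 hZB hH1
  have b5 := norm_mul_le_of_le_l2 (norm_mul_le_of_le_l2 hEM hZn) hMF
  refine ((norm_add_le _ _).trans (add_le_add ((norm_sub_le _ _).trans (add_le_add
    ((norm_sub_le _ _).trans (add_le_add hS ((norm_add_le _ _).trans (add_le_add b1 b2))))
    ((norm_add_le _ _).trans (add_le_add b3 b4)))) b5)).trans ?_
  have : 0 ≤ η ^ 2 * a := by positivity
  linarith

end IsMoorePenrose
end FactorSpaces

/-! ### Deterministic expansion of the low-rank distance -/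

section Expansion

open scoped Matrix.Norms.L2Operator

theorem rank_add_le_rank_add_rank {m n : ℕ} (A B : Matrix (Fin m) (Fin n) ℝ) :
    (A + B).rank ≤ A.rank + B.rank := by
  refine le_trans (Submodule.finrank_mono ?_) (Submodule.finrank_add_le_finrank_add_finrank _ _)
  rintro _ ⟨x, rfl⟩
  rw [Matrix.mulVecLin_add]
  exact Submodule.add_mem_sup ⟨x, rfl⟩ ⟨x, rfl⟩

theorem rank_add_le_of_le {m n a b : ℕ} {A B : Matrix (Fin m) (Fin n) ℝ} (hA : A.rank ≤ a)
    (hB : B.rank ≤ b) : (A + B).rank ≤ a + b :=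
  (rank_add_le_rank_add_rank A B).trans (add_le_add hA hB)

theorem rank_sub_le_of_le {m n a b : ℕ} {A B : Matrix (Fin m) (Fin n) ℝ} (hA : A.rank ≤ a)
    (hB : B.rank ≤ b) : (A - B).rank ≤ a + b := by
  have h : (-B).rank ≤ b := by
    have : -B = (-1 : Matrix (Fin m) (Fin m) ℝ) * B := by simp
    rw [this]
    exact (Matrix.rank_mul_le_right _ _).trans hB
  rw [sub_eq_add_neg]
  exact rank_add_le_of_le hA h

theorem rank_mul_le_of_left {m n p a : ℕ} {A : Matrix (Fin m) (Fin n) ℝ} (hA : A.rank ≤ a)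
    (B : Matrix (Fin n) (Fin p) ℝ) : (A * B).rank ≤ a := (Matrix.rank_mul_le_left A B).trans hA

theorem rank_mul_le_of_right {m n p a : ℕ} (A : Matrix (Fin m) (Fin n) ℝ)
    {B : Matrix (Fin n) (Fin p) ℝ} (hB : B.rank ≤ a) : (A * B).rank ≤ a :=
  (Matrix.rank_mul_le_right A B).trans hB

theorem abs_trace_mul_transpose_le {m n r : ℕ} {A : Matrix (Fin m) (Fin n) ℝ}
    (B : Matrix (Fin m) (Fin n) ℝ) (hr : A.rank ≤ r) {a b : ℝ} (hA : ‖A‖ ≤ a) (hB : ‖B‖ ≤ b) :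
    |(A * Bᵀ).trace| ≤ r * (a * b) := by
  refine (abs_trace_mul_le_rank A Bᵀ).trans ?_
  rw [norm_transpose_l2]
  exact mul_le_mul (by exact_mod_cast hr)
    (mul_le_mul hA hB (norm_nonneg _) ((norm_nonneg _).trans hA)) (by positivity)
    (Nat.cast_nonneg _)

/-- Arithmetic closing `abs_lowRankDist_expansion_le`. `A1`, `A2` are the distances with and without
`D`; `B1`, `B2` come from the exact tilted residual, `B3` is the second-order version of `B2`, and
`B4`, `B5`, `B6` expand the square of the tilted `D`. Since `hla3` gives `ε ≤ 8`, the block errors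
are charged to `l * a` and `l * d` times `(1 + d) ^ 2`. -/
theorem expansion_error_le {a d l r ε A1 A2 B1 B2 B3 B4 B5 B6 : ℝ} (ha : 0 ≤ a) (hd : 0 ≤ d)
    (hl : 0 ≤ l) (hR0 : 0 ≤ r) (hla : l * a ≤ 1 / 100)
    (hla3 : l ^ 2 * a ^ 3 ≤ 1) (hε0 : 0 ≤ ε) (hεeq : ε = 8 * (l ^ 2 * a ^ 3)) (hlε : l * ε ≤ l * a)
    (s1 : |A2 - B1| ≤ 8 * r * (l * ε ^ 2 * (2 * a + ε)))
    (s2 : |A1 - (B1 + 2 * B2 + (B4 + 2 * B5 + B6))|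
      ≤ 8 * r * (l * (ε + d) ^ 2 * (2 * a + d + (ε + d))))
    (c1 : |B2 - B3| ≤ 8 * r * (50 * (l * a) ^ 2 * a * d))
    (d1 : |B5| ≤ 4 * r * (8 * (l * a) * d * d))
    (d2 : |B6| ≤ 4 * r * (8 * (l * a) * d * (8 * (l * a) * d))) :
    |A1 - A2 - 2 * B3 - B4| ≤ 4000 * r * ((l * a + l * d + l ^ 2 * a ^ 3) * (1 + d) ^ 2) := by
  set κ := l ^ 2 * a ^ 3 with hκ
  have hκ0 : 0 ≤ κ := by positivity
  have hη0 : 0 ≤ l * a := by positivity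
  have hld0 : 0 ≤ l * d := by positivity
  set η := l * a
  set δ := l * d
  have hκd : κ * d ≤ κ * (1 + d) ^ 2 := by
    refine mul_le_mul_of_nonneg_left ?_ hκ0
    nlinarith
  have hηd : η * d ^ 2 ≤ η * (1 + d) ^ 2 := by
    refine mul_le_mul_of_nonneg_left ?_ hη0
    nlinarith
  have hone : (1 : ℝ) ≤ (1 + d) ^ 2 := by nlinarith
  have E1 : l * ε ^ 2 * (2 * a + ε) ≤ 192 * (η * (1 + d) ^ 2) := by
    have f1 : l * ε ^ 2 * (2 * a + ε) = ε ^ 2 * (2 * (l * a) + l * ε) := by ring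
    have f2 : ε ^ 2 ≤ 64 := by nlinarith
    rw [f1]
    have f3 : ε ^ 2 * (2 * (l * a) + l * ε) ≤ 64 * (3 * η) :=
      mul_le_mul f2 (by linarith) (by positivity) (by norm_num)
    have f4 := mul_le_mul_of_nonneg_left hone hη0
    linarith
  have E2 : l * (ε + d) ^ 2 * (2 * a + d + (ε + d)) ≤ 64 * ((3 * η + 2 * δ) * (1 + d) ^ 2) := by
    have f1 : l * (ε + d) ^ 2 * (2 * a + d + (ε + d))
        = (ε + d) ^ 2 * (2 * (l * a) + 2 * (l * d) + l * ε) := by ring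
    have f2 : (ε + d) ^ 2 ≤ (8 * (1 + d)) ^ 2 :=
      pow_le_pow_left₀ (by positivity) (by linarith) 2
    rw [f1]
    have f3 : (ε + d) ^ 2 * (2 * (l * a) + 2 * (l * d) + l * ε)
        ≤ (8 * (1 + d)) ^ 2 * (3 * η + 2 * δ) :=
      mul_le_mul f2 (by linarith) (by positivity) (by positivity)
    linarith
  have E3 : 50 * η ^ 2 * a * d ≤ 50 * (κ * (1 + d) ^ 2) := by
    have : 50 * η ^ 2 * a * d = 50 * (κ * d) := by rw [hκ]; ring
    linarith
  have E4 : 8 * η * d * d ≤ 8 * (η * (1 + d) ^ 2) := by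
    have : 8 * η * d * d = 8 * (η * d ^ 2) := by ring
    linarith
  have E5 : 8 * η * d * (8 * η * d) ≤ η * (1 + d) ^ 2 := by
    have f1 : 8 * η * d * (8 * η * d) = 64 * η * (η * d ^ 2) := by ring
    have f2 : 64 * η * (η * d ^ 2) ≤ 1 * (η * d ^ 2) :=
      mul_le_mul_of_nonneg_right (by linarith) (by positivity)
    linarith
  have E1' := mul_le_mul_of_nonneg_left E1 hR0
  have E2' := mul_le_mul_of_nonneg_left E2 hR0
  have E3' := mul_le_mul_of_nonneg_left E3 hR0
  have E4' := mul_le_mul_of_nonneg_left E4 hR0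
  have E5' := mul_le_mul_of_nonneg_left E5 hR0
  have p1 : 0 ≤ r * (η * (1 + d) ^ 2) := by positivity
  have p2 : 0 ≤ r * (δ * (1 + d) ^ 2) := by positivity
  have p3 : 0 ≤ r * (κ * (1 + d) ^ 2) := by positivity
  obtain ⟨s1a, s1b⟩ := abs_le.1 s1
  obtain ⟨s2a, s2b⟩ := abs_le.1 s2
  obtain ⟨c1a, c1b⟩ := abs_le.1 c1
  obtain ⟨d1a, d1b⟩ := abs_le.1 d1
  obtain ⟨d2a, d2b⟩ := abs_le.1 d2
  rw [abs_le]
  constructor <;> linarith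

namespace IsMoorePenrose

variable {m n : ℕ} {P : Matrix (Fin m) (Fin m) ℝ}
    {Q : Matrix (Fin n) (Fin n) ℝ} {Λ : Matrix (Fin m) (Fin n) ℝ} {L : Matrix (Fin n) (Fin m) ℝ}

/-- Since `Λ * L = P`, the pseudo-inverse `L` still nearly inverts the leading block in tilted
spaces. The three errors are the tilt, the perturbation `D` and the leakage through `1 - F`. -/
theorem norm_block_identity_le (h : IsMoorePenrose P Q Λ L) {D : Matrix (Fin m) (Fin n) ℝ}
    {l d ε g : ℝ} (hL : ‖L‖ ≤ l) (hD : ‖D‖ ≤ d)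
    {G E : Matrix (Fin m) (Fin m) ℝ} {F : Matrix (Fin n) (Fin n) ℝ}
    (hE : IsGraphProj P G E) (hG : ‖G‖ ≤ g)
    (hoff : ‖E * (Λ + D) * (1 - F)‖ ≤ ε) :
    ‖E - E * (Λ + D) * F * L * E‖ ≤ g + l * d + l * ε := by
  have key : E - E * (Λ + D) * F * L * E
      = E * (1 - P) * E - E * D * L * E + E * (Λ + D) * (1 - F) * L * E := by
    have e1 : E * (Λ + D) * F = E * (Λ + D) - E * (Λ + D) * (1 - F) := by
      rw [Matrix.mul_sub, Matrix.mul_one]; abel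
    have e2 : E * (Λ + D) * L = E * P + E * D * L := by
      rw [Matrix.mul_add, Matrix.add_mul, Matrix.mul_assoc E Λ, h.mul_inv]
    have e3 : E * (1 - P) * E = E - E * P * E := by
      rw [Matrix.mul_sub, Matrix.sub_mul, Matrix.mul_one, hE.proj.idem]
    rw [e1, Matrix.sub_mul _ _ L, Matrix.sub_mul _ _ E, e2, Matrix.add_mul _ _ E, e3]
    abel
  have b1 := norm_mul_le_of_le_l2 (hE.norm_mul_compl_base_le.trans hG) hE.proj.norm_le_one
  have b2 := norm_mul_le_of_le_l2 (norm_mul_le_of_le_l2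
    (norm_mul_le_of_le_l2 hE.proj.norm_le_one hD) hL) hE.proj.norm_le_one
  have b3 := norm_mul_le_of_le_l2 (norm_mul_le_of_le_l2 hoff hL) hE.proj.norm_le_one
  have := (norm_add_le _ _).trans (add_le_add ((norm_sub_le _ _).trans (add_le_add b1 b2)) b3)
  rw [← key] at this
  linarith

/-- `exists_block_inverse` turns `L` into an exact block inverse of norm at most `2 * l`, and
`abs_lowRankDist_sub_le` applies with `j = 2 * l`. -/
theorem abs_lowRankDist_sub_hsSq_residual_le (h : IsMoorePenrose P Q Λ L) {R : ℕ}
    (U : Matrix (Fin m) (Fin R) ℝ) (V : Matrix (Fin R) (Fin m) ℝ) (hUV : P = U * V)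
    (htr : P.trace = R) {D : Matrix (Fin m) (Fin n) ℝ} {l d ε b g : ℝ} (hl : 0 < l)
    (hL : ‖L‖ ≤ l) (hD : ‖D‖ ≤ d)
    {G E : Matrix (Fin m) (Fin m) ℝ} {H F : Matrix (Fin n) (Fin n) ℝ}
    (hE : IsGraphProj P G E) (hF : IsGraphProj Q H F) (hG : ‖G‖ ≤ g) (hH : ‖H‖ ≤ g)
    (h12 : ‖E * (Λ + D) * (1 - F)‖ ≤ ε) (h21 : ‖(1 - E) * (Λ + D) * F‖ ≤ ε)
    (h22 : ‖(1 - E) * (Λ + D) * (1 - F)‖ ≤ b)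
    (hsmall : g + l * d + l * ε ≤ 1 / 2) (hlε : l * ε ≤ 1 / 8) (hlb : l * b ≤ 1 / 8) :
    |lowRankDist R (Λ + D) - hsSq ((1 - E) * (Λ + D) * (1 - F))|
      ≤ 8 * R * (l * ε ^ 2 * (b + ε)) := by
  have h21t : ‖F * (Λᵀ + Dᵀ) * (1 - E)‖ ≤ ε := by
    rw [← norm_transpose_l2, Matrix.transpose_mul, Matrix.transpose_mul, Matrix.transpose_add,
      Matrix.transpose_transpose, Matrix.transpose_transpose, hE.proj.compl.symm, hF.proj.symm,
      ← Matrix.mul_assoc]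
    exact h21
  have i1 := (h.norm_block_identity_le hL hD hE hG h12).trans hsmall
  have i2 := (h.transpose.norm_block_identity_le (by rwa [norm_transpose_l2])
    (by rwa [norm_transpose_l2]) hF hH h21t).trans hsmall
  rw [← norm_transpose_l2] at i2
  simp only [Matrix.transpose_sub, Matrix.transpose_mul, Matrix.transpose_add,
    Matrix.transpose_transpose, hE.proj.symm, hF.proj.symm, ← Matrix.mul_assoc] at i2
  obtain ⟨J, hJE, hFJ, hEJ, hJF, hJ⟩ := exists_block_inverse hE.proj hF.proj L i1 i2
  have hfac : E = (P + G) * U * (V * E) := by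
    calc E = (P + G) * P * E := by
          rw [Matrix.add_mul, h.left.idem, hE.right_self, hE.mem]
      _ = (P + G) * (U * V) * E := by rw [← hUV]
      _ = _ := by simp only [Matrix.mul_assoc]
  have := abs_lowRankDist_sub_le hE.proj hF.proj _ _ hfac (hE.trace_eq.trans htr) hJE hFJ hEJ hJF
    (by positivity : 0 < 2 * l) (hJ.trans (by linarith)) h21 h12 h22 (by linarith) (by linarith)
  linarith

/-- Both distances are read off from trailing blocks in one decomposition, built from `e` alone. The
tilted projections are then replaced by `P` and `Q`, at the cost of low-rank errors. -/
theorem abs_lowRankDist_expansion_le (h : IsMoorePenrose P Q Λ L) {R : ℕ}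
    (U : Matrix (Fin m) (Fin R) ℝ) (V : Matrix (Fin R) (Fin m) ℝ) (hUV : P = U * V)
    (htr : P.trace = R) {e D : Matrix (Fin m) (Fin n) ℝ} {l a d : ℝ} (hl : 0 < l)
    (hL : ‖L‖ ≤ l) (he : ‖e‖ ≤ a) (hD : ‖D‖ ≤ d) (hla : l * a ≤ 1 / 100) (hld : l * d ≤ 1 / 100)
    (hla3 : l ^ 2 * a ^ 3 ≤ 1) :
    |lowRankDist R (Λ + e + D) - lowRankDist R (Λ + e)
        - 2 * (((1 - P) * e * (1 - Q) - secondOrderTerm P Q L e) * Dᵀ).trace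
        - hsSq ((1 - P) * D * (1 - Q))|
      ≤ 4000 * R * ((l * a + l * d + l ^ 2 * a ^ 3) * (1 + d) ^ 2) := by
  have het : ‖eᵀ‖ ≤ a := by rwa [norm_transpose_l2]
  have hLt : ‖Lᵀ‖ ≤ l := by rwa [norm_transpose_l2]
  have ha : 0 ≤ a := (norm_nonneg _).trans he
  have hd : 0 ≤ d := (norm_nonneg _).trans hD
  have hη0 : 0 ≤ l * a := by positivity
  have hld0 : 0 ≤ l * d := by positivity
  have hR0 : (0 : ℝ) ≤ R := Nat.cast_nonneg R
  have hG := h.norm_graphSlope_le hL he hla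
  have hH := h.transpose.norm_graphSlope_le hLt het hla
  obtain ⟨E, hE⟩ := exists_isGraphProj h.left (h.left_mul_graphSlope e) (h.graphSlope_mul_left e)
  obtain ⟨F, hF⟩ := exists_isGraphProj h.right (h.transpose.left_mul_graphSlope eᵀ)
    (h.transpose.graphSlope_mul_left eᵀ)
  have o21 := h.norm_off_diagonal_le hL he hla hE hF
  have o12 : ‖E * (Λ + e) * (1 - F)‖ ≤ 8 * (l * a) ^ 2 * a := by
    have := h.transpose.norm_off_diagonal_le hLt het hla hF
      (by simpa only [Matrix.transpose_transpose] using hE)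
    rw [← norm_transpose_l2, Matrix.transpose_mul, Matrix.transpose_mul, Matrix.transpose_add,
      Matrix.transpose_transpose, Matrix.transpose_transpose, hF.proj.compl.symm, hE.proj.symm,
      ← Matrix.mul_assoc] at this
    exact this
  obtain ⟨r1, r2⟩ := h.norm_residual_sub_le hL he hla hE hF
  set T := secondOrderTerm P Q L e with hT
  set ε := 8 * (l * a) ^ 2 * a with hε
  have hε0 : 0 ≤ ε := by positivity
  have hεeq : ε = 8 * (l ^ 2 * a ^ 3) := by rw [hε]; ring
  have hlε : l * ε ≤ l * a := by
    have e1 : l * ε = l * a * (8 * (l * a) ^ 2) := by rw [hε]; ring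
    have e2 : 8 * (l * a) ^ 2 ≤ 1 := by nlinarith
    rw [e1]
    exact mul_le_of_le_one_right hη0 e2
  have s1 := h.abs_lowRankDist_sub_hsSq_residual_le U V hUV htr hl hL he hE hF hG hH o12 o21 r1
    (by linarith) (by linarith) (by linarith)
  have hsplit : ∀ (A : Matrix (Fin m) (Fin m) ℝ) (B : Matrix (Fin n) (Fin n) ℝ),
      A * (Λ + (e + D)) * B = A * (Λ + e) * B + A * D * B := by
    intro A B
    rw [← add_assoc, Matrix.mul_add _ _ D, Matrix.add_mul]
  have bound : ∀ {A : Matrix (Fin m) (Fin m) ℝ} {B : Matrix (Fin n) (Fin n) ℝ} {x : ℝ},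
      IsOrthProj A → IsOrthProj B → ‖A * (Λ + e) * B‖ ≤ x →
      ‖A * (Λ + (e + D)) * B‖ ≤ x + d := by
    intro A B x hA hB hx
    rw [hsplit]
    have := norm_mul_le_of_le_l2 (norm_mul_le_of_le_l2 hA.norm_le_one hD) hB.norm_le_one
    refine (norm_add_le _ _).trans (add_le_add hx (this.trans ?_))
    linarith
  -- The same `E`, `F` as in `s1`, so that the square of the residual of `Λ + e` cancels. The
  -- perturbation `D` enters the off-diagonal blocks at full size `d`, which the factor `(1 + d) ^
  -- 2` tolerates.
  have s2 := h.abs_lowRankDist_sub_hsSq_residual_le (D := e + D) U V hUV htr hl hL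
    ((norm_add_le _ _).trans (add_le_add he hD)) hE hF hG hH
    (bound hE.proj hF.proj.compl o12) (bound hE.proj.compl hF.proj o21)
    (bound hE.proj.compl hF.proj.compl r1) (by linarith) (by linarith) (by linarith)
  rw [hsplit, hsSq_add, ← add_assoc Λ] at s2
  have hPr : P.rank ≤ R := by
    have := trace_eq_rank_of_idem h.left.idem
    rw [htr] at this
    exact_mod_cast this.ge
  have hEr : E.rank ≤ R := by
    have := trace_eq_rank_of_idem hE.proj.idem
    rw [hE.trace_eq, htr] at this
    exact_mod_cast this.ge
  have hΛr : Λ.rank ≤ R := by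
    rw [← h.left_mul]; exact rank_mul_le_of_left hPr Λ
  have hLr : L.rank ≤ R := by
    rw [← h.inv_left]; exact rank_mul_le_of_right L hPr
  have hLtr : Lᵀ.rank ≤ R := by rwa [Matrix.rank_transpose]
  have hQr : Q.rank ≤ R := by
    rw [← h.inv_mul]; exact rank_mul_le_of_left hLr Λ
  have hFr : F.rank ≤ R := by
    have h1 := trace_eq_rank_of_idem hF.proj.idem
    rw [hF.trace_eq, trace_eq_rank_of_idem h.right.idem] at h1
    have : Q.rank = F.rank := by exact_mod_cast h1
    rwa [← this]
  have hTr : T.rank ≤ R + R + R := by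
    rw [hT, secondOrderTerm]
    refine rank_add_le_of_le (rank_add_le_of_le ?_ ?_) ?_
    · exact rank_mul_le_of_left (rank_mul_le_of_right _ hLr) _
    · rw [Matrix.transpose_mul]
      exact rank_mul_le_of_left (rank_mul_le_of_left hLtr _) _
    · exact rank_mul_le_of_right _ (rank_mul_le_of_right _ hLtr)
  have hsw : ∀ A : Matrix (Fin m) (Fin n) ℝ, (1 - E) * A * (1 - F) - (1 - P) * A * (1 - Q)
      = (P - E) * (A * (1 - F)) + (1 - P) * A * (Q - F) := by
    intro A
    simp only [Matrix.mul_sub, Matrix.sub_mul, Matrix.mul_one, Matrix.one_mul, Matrix.mul_assoc]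
    abel
  have hswr : ∀ A : Matrix (Fin m) (Fin n) ℝ,
      ((1 - E) * A * (1 - F) - (1 - P) * A * (1 - Q)).rank ≤ (R + R) + (R + R) := by
    intro A
    rw [hsw]
    exact rank_add_le_of_le (rank_mul_le_of_left (rank_sub_le_of_le hPr hEr) _)
      (rank_mul_le_of_right _ (rank_sub_le_of_le hQr hFr))
  -- `R` from `Λ`, `4R` from exchanging the projections around `e`, `3R` from `T`: this is the `8 *
  -- r` of `c1` in `expansion_error_le`.
  have hres : ((1 - E) * (Λ + e) * (1 - F) - ((1 - P) * e * (1 - Q) - T)).rank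
      ≤ R + ((R + R) + (R + R)) + (R + R + R) := by
    have : (1 - E) * (Λ + e) * (1 - F) - ((1 - P) * e * (1 - Q) - T)
        = (1 - E) * Λ * (1 - F) + ((1 - E) * e * (1 - F) - (1 - P) * e * (1 - Q)) + T := by
      rw [Matrix.mul_add, Matrix.add_mul]; abel
    rw [this]
    exact rank_add_le_of_le (rank_add_le_of_le
      (rank_mul_le_of_left (rank_mul_le_of_right _ hΛr) _) (hswr e)) hTr
  have c1 := abs_trace_mul_transpose_le D hres r2 hD
  rw [Matrix.sub_mul, Matrix.trace_sub] at c1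
  have c2 : ((1 - E) * (Λ + e) * (1 - F) * ((1 - E) * D * (1 - F))ᵀ).trace
      = ((1 - E) * (Λ + e) * (1 - F) * Dᵀ).trace := by
    simp only [Matrix.transpose_mul, hE.proj.compl.symm, hF.proj.compl.symm, ← Matrix.mul_assoc]
    rw [Matrix.mul_assoc _ (1 - F) (1 - F), hF.proj.compl.idem, Matrix.trace_mul_comm,
      ← Matrix.mul_assoc, ← Matrix.mul_assoc, ← Matrix.mul_assoc, hE.proj.compl.idem]
  rw [c2] at s2
  set Y := (1 - P) * D * (1 - Q) with hY
  set X := (1 - E) * D * (1 - F) - Y with hX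
  have hXn : ‖X‖ ≤ 8 * (l * a) * d := by
    rw [hX, hY, hsw]
    have b1 := hE.norm_sub_le.trans (mul_le_mul_of_nonneg_left hG zero_le_two)
    have b2 := hF.norm_sub_le.trans (mul_le_mul_of_nonneg_left hH zero_le_two)
    rw [norm_sub_rev] at b1 b2
    have b3 := norm_mul_le_of_le_l2 b1 (norm_mul_le_of_le_l2 hD hF.proj.compl.norm_le_one)
    have b4 := norm_mul_le_of_le_l2 (norm_mul_le_of_le_l2 h.left.compl.norm_le_one hD) b2
    refine (norm_add_le _ _).trans ((add_le_add b3 b4).trans ?_)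
    linarith
  have hYn : ‖Y‖ ≤ d := by
    have := norm_mul_le_of_le_l2 (norm_mul_le_of_le_l2 h.left.compl.norm_le_one hD)
      h.right.compl.norm_le_one
    linarith
  have hYX : (1 - E) * D * (1 - F) = Y + X := by rw [hX]; abel
  rw [hYX, hsSq_add, trace_mul_transpose_comm Y] at s2
  have d1 := abs_trace_mul_transpose_le Y (hswr D) hXn hYn
  have d2 := abs_trace_mul_transpose_le X (hswr D) hXn hXn
  rw [← hY, ← hX] at d1 d2
  change |hsSq X| ≤ _ at d2
  push_cast at c1 d1 d2
  refine expansion_error_le ha hd hl.le hR0 hla hla3 hε0 hεeq hlε s1 s2 ?_ ?_ ?_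
  · convert c1 using 2; ring
  · convert d1 using 2; ring
  · convert d2 using 2; ring

end IsMoorePenrose
end Expansion

/-! ### Translation to the panel model: pseudo-inverse, score and Hessian terms -/

section PanelAlgebra

open scoped Matrix.Norms.L2Operator

theorem colProj_eq_of_isUnit {m p : ℕ} (A : Matrix (Fin m) (Fin p) ℝ)
    (h : IsUnit (Aᵀ * A).det) : colProj A = A * (Aᵀ * A)⁻¹ * Aᵀ := by
  refine colProj_eq A _ ?_
  rw [Matrix.mul_nonsing_inv _ h, Matrix.one_mul]

theorem trace_colProj_of_isUnit {m p : ℕ} (A : Matrix (Fin m) (Fin p) ℝ)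
    (h : IsUnit (Aᵀ * A).det) : (colProj A).trace = p := by
  rw [colProj_eq_of_isUnit A h, Matrix.trace_mul_comm, ← Matrix.mul_assoc,
    Matrix.mul_nonsing_inv _ h]
  simp

/-- The Moore-Penrose inverse of `λ f'` for `λ`, `f` of full column rank. -/
noncomputable def factorInverse {N T R : ℕ} (lam : Matrix (Fin N) (Fin R) ℝ)
    (f : Matrix (Fin T) (Fin R) ℝ) : Matrix (Fin T) (Fin N) ℝ :=
  f * (fᵀ * f)⁻¹ * ((lamᵀ * lam)⁻¹ * lamᵀ)

theorem transpose_gram_inv {m p : ℕ} (A : Matrix (Fin m) (Fin p) ℝ) :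
    ((Aᵀ * A)⁻¹)ᵀ = (Aᵀ * A)⁻¹ := by
  rw [Matrix.transpose_nonsing_inv, Matrix.transpose_mul, Matrix.transpose_transpose]

theorem transpose_factorInverse {N T R : ℕ} (lam : Matrix (Fin N) (Fin R) ℝ)
    (f : Matrix (Fin T) (Fin R) ℝ) : (factorInverse lam f)ᵀ = factorInverse f lam := by
  simp only [factorInverse, Matrix.transpose_mul, transpose_gram_inv, Matrix.transpose_transpose,
    Matrix.mul_assoc]

theorem isMoorePenrose_factorInverse {N T R : ℕ} (lam : Matrix (Fin N) (Fin R) ℝ)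
    (f : Matrix (Fin T) (Fin R) ℝ) (hl : IsUnit (lamᵀ * lam).det) (hf : IsUnit (fᵀ * f).det) :
    IsMoorePenrose (colProj lam) (colProj f) (lam * fᵀ) (factorInverse lam f) := by
  have hft : fᵀ * colProj f = fᵀ := by
    rw [← (isOrthProj_colProj f).symm, ← Matrix.transpose_mul, colProj_mul_self]
  have hlt : lamᵀ * colProj lam = lamᵀ := by
    rw [← (isOrthProj_colProj lam).symm, ← Matrix.transpose_mul, colProj_mul_self]
  refine ⟨isOrthProj_colProj _, isOrthProj_colProj _, ?_, ?_, ?_, ?_, ?_, ?_⟩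
  · rw [← Matrix.mul_assoc, colProj_mul_self]
  · rw [Matrix.mul_assoc, hft]
  · calc lam * fᵀ * factorInverse lam f
        = lam * (fᵀ * f * (fᵀ * f)⁻¹) * (lamᵀ * lam)⁻¹ * lamᵀ := by
          simp only [factorInverse, Matrix.mul_assoc]
      _ = colProj lam := by
          rw [Matrix.mul_nonsing_inv _ hf, Matrix.mul_one, colProj_eq_of_isUnit lam hl]
  · calc factorInverse lam f * (lam * fᵀ)
        = f * (fᵀ * f)⁻¹ * ((lamᵀ * lam)⁻¹ * (lamᵀ * lam)) * fᵀ := by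
          simp only [factorInverse, Matrix.mul_assoc]
      _ = colProj f := by
          rw [Matrix.nonsing_inv_mul _ hl, Matrix.mul_one, colProj_eq_of_isUnit f hf]
  · rw [factorInverse, ← Matrix.mul_assoc, ← Matrix.mul_assoc _ f, colProj_mul_self]
  · rw [factorInverse, Matrix.mul_assoc, Matrix.mul_assoc _ lamᵀ, hlt]

/-- The Gram matrix of `A * (Aᵀ * A)⁻¹` is `(Aᵀ * A)⁻¹`. -/
theorem norm_sq_mul_gram_inv_le {m p : ℕ} (A : Matrix (Fin m) (Fin p) ℝ)
    (h : IsUnit (Aᵀ * A).det) : ‖A * (Aᵀ * A)⁻¹‖ ^ 2 = ‖(Aᵀ * A)⁻¹‖ := by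
  have h1 := Matrix.l2_opNorm_conjTranspose_mul_self (A * (Aᵀ * A)⁻¹)
  rw [Matrix.conjTranspose_eq_transpose_of_trivial, Matrix.transpose_mul, transpose_gram_inv,
    Matrix.mul_assoc, ← Matrix.mul_assoc Aᵀ, Matrix.mul_nonsing_inv _ h, Matrix.mul_one] at h1
  rw [sq, ← h1]

theorem norm_factorInverse_le {N T R : ℕ} (lam : Matrix (Fin N) (Fin R) ℝ)
    (f : Matrix (Fin T) (Fin R) ℝ) (hl : IsUnit (lamᵀ * lam).det) (hf : IsUnit (fᵀ * f).det)
    {a b : ℝ} (ha : ‖(lamᵀ * lam)⁻¹‖ ≤ a) (hb : ‖(fᵀ * f)⁻¹‖ ≤ b) :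
    ‖factorInverse lam f‖ ≤ Real.sqrt (a * b) := by
  have h1 := norm_sq_mul_gram_inv_le f hf
  have h2 := norm_sq_mul_gram_inv_le lam hl
  rw [← norm_transpose_l2 (lam * _), Matrix.transpose_mul, transpose_gram_inv] at h2
  apply Real.le_sqrt_of_sq_le
  have h3 := Matrix.l2_opNorm_mul (f * (fᵀ * f)⁻¹) ((lamᵀ * lam)⁻¹ * lamᵀ)
  calc ‖factorInverse lam f‖ ^ 2
      ≤ (‖f * (fᵀ * f)⁻¹‖ * ‖(lamᵀ * lam)⁻¹ * lamᵀ‖) ^ 2 := pow_le_pow_left₀ (norm_nonneg _) h3 2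
    _ = ‖(lamᵀ * lam)⁻¹‖ * ‖(fᵀ * f)⁻¹‖ := by rw [mul_pow, h1, h2, mul_comm]
    _ ≤ a * b := mul_le_mul ha hb (norm_nonneg _) ((norm_nonneg _).trans ha)

/-- Transposition, cyclicity and idempotence of the annihilators match the summands one by one, in
reverse order. -/
theorem trace_secondOrderTerm {N T R : ℕ} (X e : Matrix (Fin N) (Fin T) ℝ)
    (lam : Matrix (Fin N) (Fin R) ℝ) (f : Matrix (Fin T) (Fin R) ℝ) :
    (secondOrderTerm (colProj lam) (colProj f) (factorInverse lam f) e * Xᵀ).trace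
      = (e * annih f * eᵀ * annih lam * X * f * (fᵀ * f)⁻¹ * (lamᵀ * lam)⁻¹ * lamᵀ).trace
      + (eᵀ * annih lam * e * annih f * Xᵀ * lam * (lamᵀ * lam)⁻¹ * (fᵀ * f)⁻¹ * fᵀ).trace
      + (eᵀ * annih lam * X * annih f * eᵀ * lam * (lamᵀ * lam)⁻¹ * (fᵀ * f)⁻¹ * fᵀ).trace := by
  have hM := (isOrthProj_colProj lam).compl
  have hM' := (isOrthProj_colProj f).compl
  change IsOrthProj (annih lam) at hM
  change IsOrthProj (annih f) at hM'
  have e1 : e * annih f * eᵀ * annih lam * X * f * (fᵀ * f)⁻¹ * (lamᵀ * lam)⁻¹ * lamᵀ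
      = e * annih f * eᵀ * annih lam * X * factorInverse lam f := by
    simp only [factorInverse, Matrix.mul_assoc]
  have e2 : eᵀ * annih lam * e * annih f * Xᵀ * lam * (lamᵀ * lam)⁻¹ * (fᵀ * f)⁻¹ * fᵀ
      = eᵀ * annih lam * e * annih f * Xᵀ * (factorInverse lam f)ᵀ := by
    rw [transpose_factorInverse]
    simp only [factorInverse, Matrix.mul_assoc]
  have e3 : eᵀ * annih lam * X * annih f * eᵀ * lam * (lamᵀ * lam)⁻¹ * (fᵀ * f)⁻¹ * fᵀ
      = eᵀ * annih lam * X * annih f * eᵀ * (factorInverse lam f)ᵀ := by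
    rw [transpose_factorInverse]
    simp only [factorInverse, Matrix.mul_assoc]
  rw [e1, e2, e3, secondOrderTerm]
  change ((annih lam * e * factorInverse lam f * (e * annih f)
    + (annih lam * e * factorInverse lam f)ᵀ * (annih lam * e * annih f)
    + annih lam * e * annih f * (annih f * eᵀ * (factorInverse lam f)ᵀ)) * Xᵀ).trace = _
  set L := factorInverse lam f
  set M := annih lam
  set M' := annih f
  rw [Matrix.add_mul, Matrix.add_mul, Matrix.trace_add, Matrix.trace_add]
  have f1 : (M * e * L * (e * M') * Xᵀ).trace = (eᵀ * M * X * M' * eᵀ * Lᵀ).trace := by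
    rw [trace_mul_transpose_comm]
    simp only [Matrix.transpose_mul, hM.symm, hM'.symm, ← Matrix.mul_assoc]
    rw [Matrix.trace_mul_comm, Matrix.trace_mul_comm (eᵀ * M * X * M' * eᵀ)]
    rw [Matrix.trace_mul_comm]
    simp only [← Matrix.mul_assoc]
    rw [Matrix.mul_assoc _ eᵀ M, Matrix.trace_mul_comm _ (eᵀ * M)]
    simp only [← Matrix.mul_assoc]
    rw [Matrix.trace_mul_comm]
    simp only [← Matrix.mul_assoc]
  have f2 : ((M * e * L)ᵀ * (M * e * M') * Xᵀ).trace = (eᵀ * M * e * M' * Xᵀ * Lᵀ).trace := by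
    rw [Matrix.trace_mul_comm (eᵀ * M * e * M' * Xᵀ)]
    simp only [Matrix.transpose_mul, hM.symm, ← Matrix.mul_assoc]
    rw [Matrix.mul_assoc _ M M, hM.idem]
  have f3 : (M * e * M' * (M' * eᵀ * Lᵀ) * Xᵀ).trace = (e * M' * eᵀ * M * X * L).trace := by
    rw [trace_mul_transpose_comm, Matrix.mul_assoc (e * M' * eᵀ * M) X L,
      Matrix.trace_mul_comm (e * M' * eᵀ * M)]
    simp only [Matrix.transpose_mul, hM.symm, hM'.symm, Matrix.transpose_transpose,
      ← Matrix.mul_assoc]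
    rw [Matrix.mul_assoc _ M' M', hM'.idem]
  rw [f1, f2, f3]
  ring

variable {K N T R : ℕ}

theorem lincomb_sub (β γ : EuclideanSpace ℝ (Fin K)) (X : Fin K → Matrix (Fin N) (Fin T) ℝ) :
    lincomb (β - γ) X = lincomb β X - lincomb γ X := by
  simp [lincomb, sub_smul]

theorem trace_mul_transpose_lincomb (A : Matrix (Fin N) (Fin T) ℝ) (δ : EuclideanSpace ℝ (Fin K))
    (X : Fin K → Matrix (Fin N) (Fin T) ℝ) :
    (A * (lincomb δ X)ᵀ).trace = ∑ k, δ k * (A * (X k)ᵀ).trace := by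
  simp [lincomb, Matrix.transpose_sum, Matrix.mul_sum, Matrix.trace_sum]

theorem norm_lincomb_le (δ : EuclideanSpace ℝ (Fin K)) (X : Fin K → Matrix (Fin N) (Fin T) ℝ)
    {b : Fin K → ℝ} (hb : ∀ k, ‖X k‖ ≤ b k) : ‖lincomb δ X‖ ≤ ‖δ‖ * ∑ k, b k := by
  rw [lincomb, Finset.mul_sum]
  refine (norm_sum_le _ _).trans (Finset.sum_le_sum fun k _ => ?_)
  rw [norm_smul]
  exact mul_le_mul (PiLp.norm_apply_le δ k) (hb k) (norm_nonneg _) (norm_nonneg _)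

theorem profileObj_eq (Y : Matrix (Fin N) (Fin T) ℝ) (X : Fin K → Matrix (Fin N) (Fin T) ℝ)
    (β : EuclideanSpace ℝ (Fin K)) :
    profileObj R Y X β = 1 / ((N : ℝ) * T) * lowRankDist R (Y - lincomb β X) := by
  rw [profileObj, lowRankDist, Real.mul_iInf_of_nonneg (by positivity)]
  simp only [hsNorm_sq]

theorem hsSq_annih_lincomb (δ : EuclideanSpace ℝ (Fin K)) (X : Fin K → Matrix (Fin N) (Fin T) ℝ)
    (lam : Matrix (Fin N) (Fin R) ℝ) (f : Matrix (Fin T) (Fin R) ℝ) :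
    1 / ((N : ℝ) * T) * hsSq (annih lam * lincomb δ X * annih f)
      = δ.ofLp ⬝ᵥ (matW X lam f *ᵥ δ.ofLp) := by
  have hM : IsOrthProj (annih lam) := (isOrthProj_colProj lam).compl
  have hM' : IsOrthProj (annih f) := (isOrthProj_colProj f).compl
  have h1 : hsSq (annih lam * lincomb δ X * annih f)
      = (annih lam * lincomb δ X * annih f * (lincomb δ X)ᵀ).trace := by
    rw [hsSq]
    simp only [Matrix.transpose_mul, hM.symm, hM'.symm]
    rw [← Matrix.mul_assoc, Matrix.trace_mul_comm]
    simp only [← Matrix.mul_assoc]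
    rw [Matrix.mul_assoc _ (annih f) (annih f), hM'.idem, Matrix.mul_assoc _ _ (annih lam)]
    rw [hM.idem, Matrix.trace_mul_comm (annih lam * lincomb δ X * annih f)]
    simp only [← Matrix.mul_assoc]
  rw [h1, trace_mul_transpose_lincomb]
  simp only [dotProduct, Matrix.mulVec, matW, Matrix.of_apply, Finset.mul_sum]
  rw [Finset.sum_comm]
  refine Finset.sum_congr rfl fun k _ => ?_
  simp only [lincomb, Matrix.mul_sum, Matrix.sum_mul, Matrix.trace_sum, Matrix.mul_smul,
    Matrix.smul_mul, Matrix.trace_smul, smul_eq_mul, Finset.mul_sum]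
  refine Finset.sum_congr rfl fun l _ => ?_
  ring

/-- The remainder of the quadratic expansion of the profile objective around `β⁰`. -/
noncomputable def expansionRemainder (R : ℕ) (β0 : EuclideanSpace ℝ (Fin K))
    (X : Fin K → Matrix (Fin N) (Fin T) ℝ) (lam : Matrix (Fin N) (Fin R) ℝ)
    (f : Matrix (Fin T) (Fin R) ℝ) (e : Matrix (Fin N) (Fin T) ℝ)
    (β : EuclideanSpace ℝ (Fin K)) : ℝ :=
  profileObj R (outcome β0 X lam f e) X β - profileObj R (outcome β0 X lam f e) X β0
    + 2 / Real.sqrt ((N : ℝ) * T) * ((β - β0).ofLp ⬝ᵥ (vecC1 X lam f e + vecC2 X lam f e))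
    - (β - β0).ofLp ⬝ᵥ (matW X lam f *ᵥ (β - β0).ofLp)

/-- The perturbation is `β⁰ - β` while the expansion is in `β - β⁰`: only the linear term changes
sign. -/
theorem expansionRemainder_eq (hN : 0 < N) (hT : 0 < T) (β0 : EuclideanSpace ℝ (Fin K))
    (X : Fin K → Matrix (Fin N) (Fin T) ℝ) (lam : Matrix (Fin N) (Fin R) ℝ)
    (f : Matrix (Fin T) (Fin R) ℝ) (e : Matrix (Fin N) (Fin T) ℝ)
    (β : EuclideanSpace ℝ (Fin K)) :
    expansionRemainder R β0 X lam f e β = 1 / ((N : ℝ) * T) *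
      (lowRankDist R (lam * fᵀ + e + lincomb (β0 - β) X) - lowRankDist R (lam * fᵀ + e)
        - 2 * ((annih lam * e * annih f
          - secondOrderTerm (colProj lam) (colProj f) (factorInverse lam f) e)
            * (lincomb (β0 - β) X)ᵀ).trace
        - hsSq (annih lam * lincomb (β0 - β) X * annih f)) := by
  have hNT : (0 : ℝ) < (N : ℝ) * T := by positivity
  have hs : Real.sqrt ((N : ℝ) * T) ≠ 0 := (Real.sqrt_pos.2 hNT).ne'
  have hM : IsOrthProj (annih lam) := (isOrthProj_colProj lam).compl
  have hM' : IsOrthProj (annih f) := (isOrthProj_colProj f).compl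
  have h1 : outcome β0 X lam f e - lincomb β X = lam * fᵀ + e + lincomb (β0 - β) X := by
    rw [outcome, lincomb_sub]; abel
  have h2 : outcome β0 X lam f e - lincomb β0 X = lam * fᵀ + e := by
    rw [outcome]; abel
  have h3 : ∀ k, ((annih lam * e * annih f
      - secondOrderTerm (colProj lam) (colProj f) (factorInverse lam f) e) * (X k)ᵀ).trace
      = Real.sqrt ((N : ℝ) * T) * (vecC1 X lam f e k + vecC2 X lam f e k) := by
    intro k
    have c1 : (annih lam * e * annih f * (X k)ᵀ).trace = (annih lam * X k * annih f * eᵀ).trace := by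
      rw [trace_mul_transpose_comm]
      simp only [Matrix.transpose_mul, hM.symm, hM'.symm]
      rw [← Matrix.mul_assoc, ← Matrix.mul_assoc, Matrix.trace_mul_comm]
      simp only [← Matrix.mul_assoc]
    rw [Matrix.sub_mul, Matrix.trace_sub, trace_secondOrderTerm, c1, vecC1, vecC2]
    field_simp
    ring
  have h4 : hsSq (annih lam * lincomb (β0 - β) X * annih f)
      = hsSq (annih lam * lincomb (β - β0) X * annih f) := by
    rw [← hsSq_neg]
    congr 1
    rw [lincomb_sub, lincomb_sub, ← Matrix.neg_mul, ← Matrix.mul_neg, neg_sub]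
  rw [expansionRemainder, profileObj_eq, profileObj_eq, h1, h2, trace_mul_transpose_lincomb, h4,
    mul_sub, mul_sub, mul_sub, hsSq_annih_lincomb]
  simp only [h3, dotProduct, Pi.add_apply, PiLp.sub_apply]
  have h5 : ∑ k, (β0 k - β k) * (Real.sqrt ((N : ℝ) * T) * (vecC1 X lam f e k + vecC2 X lam f e k))
      = -(Real.sqrt ((N : ℝ) * T)
        * ∑ k, (β k - β0 k) * (vecC1 X lam f e k + vecC2 X lam f e k)) := by
    rw [Finset.mul_sum, ← Finset.sum_neg_distrib]
    exact Finset.sum_congr rfl fun k _ => by ring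
  rw [h5]
  have h6 : 2 / Real.sqrt ((N : ℝ) * T) = 1 / ((N : ℝ) * T) * (2 * Real.sqrt ((N : ℝ) * T)) := by
    rw [div_eq_iff hs]
    have := Real.mul_self_sqrt hNT.le
    field_simp
    nlinarith
  rw [h6]
  ring

end PanelAlgebra

/-! ### Inverse Gram bounds, remainder bound in terms of the rates, limits of the rates -/

section Probability

open scoped Matrix.Norms.L2Operator

/-- Determinant and inverse are continuous at `S`. The radius is entrywise because convergence in
probability is assumed entry by entry. -/
theorem exists_inverse_bound_of_det_isUnit {R : ℕ} {S : Matrix (Fin R) (Fin R) ℝ}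
    (hS : IsUnit S.det) : ∃ c > 0, ∃ τ > 0, ∀ A : Matrix (Fin R) (Fin R) ℝ,
      (∀ r s, dist (A r s) (S r s) < τ) → IsUnit A.det ∧ ‖A⁻¹‖ ≤ c := by
  have hdet : ∀ᶠ A in 𝓝 S, IsUnit A.det := by
    have hc : Continuous fun A : Matrix (Fin R) (Fin R) ℝ => A.det := continuous_id.matrix_det
    filter_upwards [hc.continuousAt.eventually_ne hS.ne_zero] with A hA
    exact isUnit_iff_ne_zero.2 hA
  have hinv : ContinuousAt (fun A : Matrix (Fin R) (Fin R) ℝ => A⁻¹) S := by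
    refine continuousAt_matrix_inv _ ?_
    simpa using NormedRing.inverse_continuousAt (hS.unit)
  have hnorm : ∀ᶠ A in 𝓝 S, ‖A⁻¹‖ < ‖S⁻¹‖ + 1 :=
    hinv.norm.eventually_lt_const (by linarith)
  have hboth := hdet.and hnorm
  obtain ⟨τ, hτ, hball⟩ := (Metric.mem_nhds_iff (α := Fin R → Fin R → ℝ)).1 hboth
  refine ⟨‖S⁻¹‖ + 1, by positivity, τ, hτ, fun A hA => ?_⟩
  have hdist : @dist (Fin R → Fin R → ℝ) _ A S < τ :=
    (dist_pi_lt_iff hτ).2 fun r => (dist_pi_lt_iff hτ).2 fun s => hA r s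
  obtain ⟨h1, h2⟩ := hball (Metric.mem_ball.2 hdist)
  exact ⟨h1, h2.le⟩

/-- A union bound over the finitely many entries; `c` depends only on the limit matrix and so serves
every `δ`. -/
theorem PlimPosDef.exists_inverse_bound {Ω : Type*} [MeasurableSpace Ω] {P : Measure Ω}
    [IsProbabilityMeasure P] {R : ℕ} {A : ℕ → Ω → Matrix (Fin R) (Fin R) ℝ}
    (h : PlimPosDef P A) : ∃ c > 0, ∀ δ > 0, ∀ᶠ n in atTop,
      P.real {ω | ¬ (IsUnit (A n ω).det ∧ ‖(A n ω)⁻¹‖ ≤ c)} ≤ δ := by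
  obtain ⟨S, hS, hconv⟩ := h
  obtain ⟨c, hc, τ, hτ, hA⟩ := exists_inverse_bound_of_det_isUnit
    (isUnit_iff_ne_zero.2 hS.det_pos.ne')
  refine ⟨c, hc, fun δ hδ => ?_⟩
  have hsum : Tendsto (fun n => ∑ r, ∑ s,
      P {ω | ENNReal.ofReal τ ≤ edist (A n ω r s) (S r s)}) atTop (𝓝 0) := by
    have := tendsto_finsetSum (Finset.univ : Finset (Fin R)) fun r _ =>
      tendsto_finsetSum (Finset.univ : Finset (Fin R)) fun s _ =>
        hconv r s (ENNReal.ofReal τ) (by simpa using hτ)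
    simpa using this
  filter_upwards [hsum.eventually_le_const (ENNReal.ofReal_pos.2 hδ)] with n hn
  refine ENNReal.toReal_le_of_le_ofReal hδ.le (le_trans ?_ hn)
  have hsub : {ω | ¬ (IsUnit (A n ω).det ∧ ‖(A n ω)⁻¹‖ ≤ c)}
      ⊆ ⋃ r, ⋃ s, {ω | ENNReal.ofReal τ ≤ edist (A n ω r s) (S r s)} := by
    intro ω hω
    by_contra hcon
    simp only [Set.mem_iUnion, Set.mem_ofPred_eq, not_exists, not_le] at hcon
    refine hω (hA _ fun r s => ?_)
    have := hcon r s
    rwa [edist_dist, ENNReal.ofReal_lt_ofReal_iff hτ] at this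
  refine (measure_mono hsub).trans ((measure_iUnion_fintype_le _ _).trans ?_)
  exact Finset.sum_le_sum fun r _ => measure_iUnion_fintype_le _ _

theorem gram_of_scaled_gram {N R : ℕ} (hN : 0 < N) {lam : Matrix (Fin N) (Fin R) ℝ} {c : ℝ}
    (h : IsUnit ((1 / (N : ℝ)) • (lamᵀ * lam)).det ∧ ‖((1 / (N : ℝ)) • (lamᵀ * lam))⁻¹‖ ≤ c) :
    IsUnit (lamᵀ * lam).det ∧ ‖(lamᵀ * lam)⁻¹‖ ≤ c / N := by
  have hN' : (0 : ℝ) < N := Nat.cast_pos.2 hN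
  obtain ⟨h1, h2⟩ := h
  have h3 : IsUnit (lamᵀ * lam).det := by
    rw [Matrix.det_smul] at h1
    exact isUnit_of_mul_isUnit_right h1
  refine ⟨h3, ?_⟩
  have : ((1 / (N : ℝ)) • (lamᵀ * lam))⁻¹ = (N : ℝ) • (lamᵀ * lam)⁻¹ := by
    refine Matrix.inv_eq_left_inv ?_
    rw [Matrix.smul_mul, Matrix.mul_smul, Matrix.nonsing_inv_mul _ h3, smul_smul,
      mul_one_div_cancel hN'.ne', one_smul]
  rw [this, norm_smul, Real.norm_of_nonneg hN'.le] at h2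
  rw [le_div_iff₀ hN']
  linarith

theorem abs_expansionRemainder_le {K N T R : ℕ} (hN : 0 < N) (hT : 0 < T)
    (β0 : EuclideanSpace ℝ (Fin K)) (X : Fin K → Matrix (Fin N) (Fin T) ℝ)
    (lam : Matrix (Fin N) (Fin R) ℝ) (f : Matrix (Fin T) (Fin R) ℝ)
    (e : Matrix (Fin N) (Fin T) ℝ) (β : EuclideanSpace ℝ (Fin K))
    (hl : IsUnit (lamᵀ * lam).det) (hf : IsUnit (fᵀ * f).det) {l a d : ℝ} (hl0 : 0 < l)
    (hL : ‖factorInverse lam f‖ ≤ l) (he : ‖e‖ ≤ a) (hD : ‖lincomb (β0 - β) X‖ ≤ d)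
    (hla : l * a ≤ 1 / 100) (hld : l * d ≤ 1 / 100) (hla3 : l ^ 2 * a ^ 3 ≤ 1) :
    |expansionRemainder R β0 X lam f e β|
      ≤ 1 / ((N : ℝ) * T) * (4000 * R * ((l * a + l * d + l ^ 2 * a ^ 3) * (1 + d) ^ 2)) := by
  rw [expansionRemainder_eq hN hT, abs_mul, abs_of_nonneg (by positivity : 0 ≤ 1 / ((N : ℝ) * T))]
  refine mul_le_mul_of_nonneg_left ?_ (by positivity)
  exact (isMoorePenrose_factorInverse lam f hl hf).abs_lowRankDist_expansion_le lam
    ((lamᵀ * lam)⁻¹ * lamᵀ) (by rw [colProj_eq_of_isUnit lam hl, Matrix.mul_assoc])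
    (trace_colProj_of_isUnit lam hl) hl0 hL he hD hla hld hla3

/-- The remainder bound in terms of the orders of magnitude of the factors, errors and regressors. -/
theorem abs_expansionRemainder_div_le {K N T R : ℕ} (hN : 0 < N) (hT : 0 < T)
    (β0 : EuclideanSpace ℝ (Fin K)) (X : Fin K → Matrix (Fin N) (Fin T) ℝ)
    (lam : Matrix (Fin N) (Fin R) ℝ) (f : Matrix (Fin T) (Fin R) ℝ)
    (e : Matrix (Fin N) (Fin T) ℝ) (β : EuclideanSpace ℝ (Fin K)) {cl cf A r q x : ℝ}
    {b : Fin K → ℝ} (hcl : 0 < cl) (hcf : 0 < cf)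
    (hl : IsUnit ((1 / (N : ℝ)) • (lamᵀ * lam)).det ∧ ‖((1 / (N : ℝ)) • (lamᵀ * lam))⁻¹‖ ≤ cl)
    (hf : IsUnit ((1 / (T : ℝ)) • (fᵀ * f)).det ∧ ‖((1 / (T : ℝ)) • (fᵀ * f))⁻¹‖ ≤ cf)
    (hb0 : ∀ k, 0 ≤ b k) (he : ‖e‖ ≤ A * Real.sqrt (max (N : ℝ) T))
    (hX : ∀ k, ‖X k‖ ≤ b k * Real.sqrt ((N : ℝ) * T)) (hβ : ‖β - β0‖ ≤ x)
    (hr : Real.sqrt (cl * cf) * A * (Real.sqrt (max (N : ℝ) T) / Real.sqrt ((N : ℝ) * T)) = r)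
    (hq : cl * cf * A ^ 3 * (Real.sqrt (max (N : ℝ) T) ^ 3 / ((N : ℝ) * T)) = q)
    (hr1 : r ≤ 1 / 100) (hq1 : q ≤ 1) (hx1 : Real.sqrt (cl * cf) * (∑ k, b k) * x ≤ 1 / 100) :
    |expansionRemainder R β0 X lam f e β| / (1 + Real.sqrt ((N : ℝ) * T) * ‖β - β0‖) ^ 2
      ≤ 1 / ((N : ℝ) * T) * (4000 * R * (1 + ∑ k, b k) ^ 2 *
        (r + Real.sqrt (cl * cf) * (∑ k, b k) * x + q)) := by
  have hN' : (0 : ℝ) < N := Nat.cast_pos.2 hN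
  have hT' : (0 : ℝ) < T := Nat.cast_pos.2 hT
  obtain ⟨hl1, hl2⟩ := gram_of_scaled_gram hN hl
  obtain ⟨hf1, hf2⟩ := gram_of_scaled_gram hT hf
  have hL := norm_factorInverse_le lam f hl1 hf1 hl2 hf2
  have hNT : (0 : ℝ) < (N : ℝ) * T := by positivity
  have hs : 0 < Real.sqrt ((N : ℝ) * T) := Real.sqrt_pos.2 hNT
  have hss : Real.sqrt ((N : ℝ) * T) ^ 2 = (N : ℝ) * T := Real.sq_sqrt hNT.le
  have hc : 0 < Real.sqrt (cl * cf) := Real.sqrt_pos.2 (by positivity)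
  have hcc : Real.sqrt (cl * cf) ^ 2 = cl * cf := Real.sq_sqrt (by positivity)
  have e1 : cl / N * (cf / T) = cl * cf / ((N : ℝ) * T) := by field_simp
  rw [e1, Real.sqrt_div (by positivity)] at hL
  have hB : 0 ≤ ∑ k, b k := Finset.sum_nonneg fun k _ => hb0 k
  have hδ : ‖β0 - β‖ = ‖β - β0‖ := norm_sub_rev _ _
  have hD := norm_lincomb_le (β0 - β) X hX
  rw [hδ, ← Finset.sum_mul] at hD
  set s := Real.sqrt ((N : ℝ) * T)
  set B := ∑ k, b k
  set c := Real.sqrt (cl * cf)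
  set m := Real.sqrt (max (N : ℝ) T)
  set y := ‖β - β0‖
  have hy : 0 ≤ y := norm_nonneg _
  -- With `l = c / s`, `a = A * m` and `d = y * (B * s)`, the small quantities `l a`, `l d`, `l² a³`
  -- become `r`, `c * B * y`, `q`.
  have la : c / s * (A * m) = r := by rw [← hr]; field_simp
  have ld : c / s * (y * (B * s)) = c * B * y := by field_simp
  have la3 : (c / s) ^ 2 * (A * m) ^ 3 = q := by
    rw [div_pow, hcc, hss, ← hq]; field_simp
  have hcy : c * B * y ≤ c * B * x := mul_le_mul_of_nonneg_left hβ (by positivity)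
  have hmain := abs_expansionRemainder_le hN hT β0 X lam f e β hl1 hf1 (by positivity) hL he hD
    (la.le.trans hr1) (ld.le.trans (hcy.trans hx1)) (la3.le.trans hq1)
  rw [la, ld, la3] at hmain
  have ha0 : 0 ≤ A * m := (norm_nonneg _).trans he
  have hr0 : 0 ≤ r := by rw [← la]; positivity
  have hq0 : 0 ≤ q := by rw [← la3]; positivity
  rw [div_le_iff₀ (by positivity)]
  refine hmain.trans ?_
  rw [mul_assoc (1 / ((N : ℝ) * T))]
  refine mul_le_mul_of_nonneg_left ?_ (by positivity)
  -- This trades `(1 + d) ^ 2` for the normalization of the theorem, at the cost of the constant `(1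
  -- + B) ^ 2`.
  have h1 : (1 + y * (B * s)) ^ 2 ≤ ((1 + B) * (1 + s * y)) ^ 2 := by
    refine pow_le_pow_left₀ (by positivity) ?_ 2
    have : 0 ≤ s * y := by positivity
    nlinarith
  have h2 : (r + c * B * y + q) * (1 + y * (B * s)) ^ 2
      ≤ (r + c * B * x + q) * ((1 + B) * (1 + s * y)) ^ 2 :=
    mul_le_mul (by linarith) h1 (by positivity)
      (by have : 0 ≤ c * B * y := by positivity
          linarith)
  calc 4000 * (R : ℝ) * ((r + c * B * y + q) * (1 + y * (B * s)) ^ 2)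
      ≤ 4000 * (R : ℝ) * ((r + c * B * x + q) * ((1 + B) * (1 + s * y)) ^ 2) :=
        mul_le_mul_of_nonneg_left h2 (by positivity)
    _ = _ := by ring

theorem tendsto_sqrt_max_div {N T : ℕ → ℕ} (hN : Tendsto N atTop atTop)
    (hT : Tendsto T atTop atTop) :
    Tendsto (fun n => Real.sqrt (max (N n : ℝ) (T n)) / Real.sqrt ((N n : ℝ) * T n)) atTop
      (𝓝 0) := by
  have h1 : Tendsto (fun n => max (1 / (T n : ℝ)) (1 / (N n : ℝ))) atTop (𝓝 (max 0 0)) :=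
    (tendsto_one_div_atTop_nhds_zero_nat.comp hT).max (tendsto_one_div_atTop_nhds_zero_nat.comp hN)
  have h2 := (Real.continuous_sqrt.tendsto _).comp h1
  rw [max_self, Real.sqrt_zero] at h2
  refine h2.congr' ?_
  filter_upwards [hN.eventually_gt_atTop 0, hT.eventually_gt_atTop 0] with n hn ht
  have hn' : (0 : ℝ) < N n := Nat.cast_pos.2 hn
  have ht' : (0 : ℝ) < T n := Nat.cast_pos.2 ht
  rw [← Real.sqrt_div (by positivity), Function.comp, ← max_div_div_right (by positivity)]
  congr 2 <;> field_simp

/-- The square of this ratio is the maximum of `N / T²` and `T / N²`, so `N` and `T` must not grow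
at too different rates. -/
theorem tendsto_sqrt_max_cube_div {N T : ℕ → ℕ} (hN : Tendsto N atTop atTop)
    (hT : Tendsto T atTop atTop) {κ : ℝ} (hκ : 0 < κ)
    (hNT : Tendsto (fun n => (N n : ℝ) / T n) atTop (𝓝 (κ ^ 2))) :
    Tendsto (fun n => Real.sqrt (max (N n : ℝ) (T n)) ^ 3 / ((N n : ℝ) * T n)) atTop (𝓝 0) := by
  have hTN : Tendsto (fun n => (T n : ℝ) / N n) atTop (𝓝 (κ ^ 2)⁻¹) := by
    have := hNT.inv₀ (by positivity)
    simpa using this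
  have h1 : Tendsto (fun n => max ((N n : ℝ) / T n * (1 / (T n : ℝ)))
      ((T n : ℝ) / N n * (1 / (N n : ℝ)))) atTop (𝓝 (max (κ ^ 2 * 0) ((κ ^ 2)⁻¹ * 0))) :=
    (hNT.mul (tendsto_one_div_atTop_nhds_zero_nat.comp hT)).max
      (hTN.mul (tendsto_one_div_atTop_nhds_zero_nat.comp hN))
  have h2 := (Real.continuous_sqrt.tendsto _).comp h1
  rw [mul_zero, mul_zero, max_self, Real.sqrt_zero] at h2
  refine h2.congr' ?_
  filter_upwards [hN.eventually_gt_atTop 0, hT.eventually_gt_atTop 0] with n hn ht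
  have hn' : (0 : ℝ) < N n := Nat.cast_pos.2 hn
  have ht' : (0 : ℝ) < T n := Nat.cast_pos.2 ht
  rw [Function.comp, Real.sqrt_eq_iff_mul_self_eq (by positivity) (by positivity)]
  have e1 : Real.sqrt (max (N n : ℝ) (T n)) ^ 3 / ((N n : ℝ) * T n)
      * (Real.sqrt (max (N n : ℝ) (T n)) ^ 3 / ((N n : ℝ) * T n))
      = max (N n : ℝ) (T n) ^ 3 / ((N n : ℝ) * T n) ^ 2 := by
    rw [div_mul_div_comm, ← pow_add, ← sq, show 3 + 3 = 2 * 3 from rfl, pow_mul,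
      Real.sq_sqrt (by positivity)]
  rw [e1]
  have e2 : (N n : ℝ) / T n * (1 / (T n : ℝ)) = (N n : ℝ) ^ 3 / ((N n : ℝ) * T n) ^ 2 := by
    field_simp
  have e3 : (T n : ℝ) / N n * (1 / (N n : ℝ)) = (T n : ℝ) ^ 3 / ((N n : ℝ) * T n) ^ 2 := by
    field_simp
  rw [e2, e3, max_div_div_right (by positivity)]
  congr 1
  rcases le_total (N n : ℝ) (T n) with h | h
  · rw [max_eq_right h, max_eq_right (pow_le_pow_left₀ hn'.le h 3)]
  · rw [max_eq_left h, max_eq_left (pow_le_pow_left₀ ht'.le h 3)]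

end Probability

/-! ### Stochastic order of the remainder -/

section Remainder

open scoped Matrix.Norms.L2Operator

/-- On the intersection of `K + 3` likely events the deterministic bound holds for all `β` in the
ball at once. The exceedance set of the supremum lies in the union of the complements, so no
measurability of the supremum is needed. -/
theorem isLittleOP_expansionRemainder {Ω : Type*} [MeasurableSpace Ω] (P : Measure Ω)
    [IsProbabilityMeasure P] {K R0 : ℕ} {N T : ℕ → ℕ} (β0 : EuclideanSpace ℝ (Fin K))
    {X : ∀ n, Fin K → Ω → Matrix (Fin (N n)) (Fin (T n)) ℝ}
    {lam0 : ∀ n, Ω → Matrix (Fin (N n)) (Fin R0) ℝ}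
    {f0 : ∀ n, Ω → Matrix (Fin (T n)) (Fin R0) ℝ}
    {e : ∀ n, Ω → Matrix (Fin (N n)) (Fin (T n)) ℝ}
    (hSF : StrongFactors P lam0 f0) (hSN : SpectralNormBounds P X e)
    (hN : Tendsto N atTop atTop) (hT : Tendsto T atTop atTop)
    {κ : ℝ} (hκ : 0 < κ) (hNT : Tendsto (fun n => (N n : ℝ) / T n) atTop (𝓝 (κ ^ 2)))
    {c : ℕ → ℝ} (hc : Tendsto c atTop (𝓝 0)) :
    IsLittleOP P
      (fun n ω => ⨆ β ∈ {β : EuclideanSpace ℝ (Fin K) | ‖β - β0‖ ≤ c n}, ENNReal.ofReal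
        (|expansionRemainder R0 β0 (fun k => X n k ω) (lam0 n ω) (f0 n ω) (e n ω) β|
          / (1 + Real.sqrt ((N n : ℝ) * T n) * ‖β - β0‖) ^ 2))
      (fun n => 1 / ((N n : ℝ) * T n)) := by
  intro ε hε
  obtain ⟨cl, hcl, hl⟩ := hSF.loadings.exists_inverse_bound
  obtain ⟨cf, hcf, hf⟩ := hSF.factors.exists_inverse_bound
  set bad : ℕ → Set Ω := fun n => {ω | ENNReal.ofReal (ε * |1 / ((N n : ℝ) * T n)|) <
    ⨆ β ∈ {β : EuclideanSpace ℝ (Fin K) | ‖β - β0‖ ≤ c n}, ENNReal.ofReal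
      (|expansionRemainder R0 β0 (fun k => X n k ω) (lam0 n ω) (f0 n ω) (e n ω) β|
        / (1 + Real.sqrt ((N n : ℝ) * T n) * ‖β - β0‖) ^ 2)} with hbad
  suffices h : ∀ γ > 0, ∀ᶠ n in atTop, P.real (bad n) ≤ γ by
    have h0 : Tendsto (fun n => P.real (bad n)) atTop (𝓝 0) := by
      refine tendsto_order.2 ⟨fun a ha => Eventually.of_forall fun n =>
        lt_of_lt_of_le ha measureReal_nonneg, fun a ha => ?_⟩
      filter_upwards [h (a / 2) (by positivity)] with n hn
      linarith
    exact (ENNReal.tendsto_toReal_iff (fun n => measure_ne_top P _) ENNReal.zero_ne_top).1 h0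
  intro γ hγ
  -- One share for each regressor and one each for the error, the loadings and the factors.
  have hδ : 0 < γ / (K + 3) := by positivity
  obtain ⟨A, hA⟩ := hSN.errors _ hδ
  choose b hb using fun k => hSN.regressors k _ hδ
  -- The constants supplied by `IsBigOP` may be negative; absolute values only weaken the bounds.
  set B := ∑ k, |b k|
  have hr := (tendsto_sqrt_max_div hN hT).const_mul (Real.sqrt (cl * cf) * |A|)
  have hq := (tendsto_sqrt_max_cube_div hN hT hκ hNT).const_mul (cl * cf * |A| ^ 3)
  have hx := hc.abs.const_mul (Real.sqrt (cl * cf) * B)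
  have htot := ((hr.add hx).add hq).const_mul (4000 * (R0 : ℝ) * (1 + B) ^ 2)
  simp only [abs_zero, mul_zero, add_zero] at hr hq hx htot
  filter_upwards [hr.eventually_le_const (by norm_num : (0 : ℝ) < 1 / 100),
    hq.eventually_le_const (by norm_num : (0 : ℝ) < 1),
    hx.eventually_le_const (by norm_num : (0 : ℝ) < 1 / 100), htot.eventually_le_const hε,
    hN.eventually_gt_atTop 0, hT.eventually_gt_atTop 0, hA, eventually_all.2 hb, hl _ hδ, hf _ hδ]
    with n hrn hqn hxn htotn hNn hTn hAn hbn hln hfn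
  set badE := {ω | A * |Real.sqrt (max (N n : ℝ) (T n))| < |specNorm (e n ω)|} with hbadE
  set badX := fun k => {ω | b k * |Real.sqrt ((N n : ℝ) * T n)| < |specNorm (X n k ω)|} with hbadX
  set badL := {ω | ¬ (IsUnit ((1 / (N n : ℝ)) • ((lam0 n ω)ᵀ * lam0 n ω)).det ∧
    ‖((1 / (N n : ℝ)) • ((lam0 n ω)ᵀ * lam0 n ω))⁻¹‖ ≤ cl)} with hbadL
  set badF := {ω | ¬ (IsUnit ((1 / (T n : ℝ)) • ((f0 n ω)ᵀ * f0 n ω)).det ∧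
    ‖((1 / (T n : ℝ)) • ((f0 n ω)ᵀ * f0 n ω))⁻¹‖ ≤ cf)} with hbadF
  have hsub : bad n ⊆ badE ∪ (⋃ k, badX k) ∪ badL ∪ badF := by
    intro ω hω
    by_contra hcon
    simp only [Set.mem_union, Set.mem_iUnion, not_or, not_exists] at hcon
    obtain ⟨⟨⟨hE, hX'⟩, hL⟩, hF⟩ := hcon
    rw [hbadE, Set.mem_ofPred_eq, not_lt, specNorm_eq_norm, abs_of_nonneg (norm_nonneg _),
      abs_of_nonneg (Real.sqrt_nonneg _)] at hE
    rw [hbadL, Set.mem_ofPred_eq, not_not] at hL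
    rw [hbadF, Set.mem_ofPred_eq, not_not] at hF
    have hXk : ∀ k, ‖X n k ω‖ ≤ |b k| * Real.sqrt ((N n : ℝ) * T n) := by
      intro k
      have := hX' k
      rw [hbadX, Set.mem_ofPred_eq, not_lt, specNorm_eq_norm, abs_of_nonneg (norm_nonneg _),
        abs_of_nonneg (Real.sqrt_nonneg _)] at this
      exact this.trans (mul_le_mul_of_nonneg_right (le_abs_self _) (Real.sqrt_nonneg _))
    rw [hbad, Set.mem_ofPred_eq] at hω
    refine absurd hω (not_lt.2 (iSup₂_le fun β hβ => ENNReal.ofReal_le_ofReal ?_))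
    refine (abs_expansionRemainder_div_le hNn hTn β0 (fun k => X n k ω) (lam0 n ω) (f0 n ω)
      (e n ω) β hcl hcf hL hF (fun k => abs_nonneg (b k))
      (hE.trans (mul_le_mul_of_nonneg_right (le_abs_self _) (Real.sqrt_nonneg _))) hXk
      (le_trans hβ (le_abs_self _)) rfl rfl hrn hqn hxn).trans ?_
    rw [abs_of_nonneg (by positivity : 0 ≤ 1 / ((N n : ℝ) * T n)), mul_comm ε]
    exact mul_le_mul_of_nonneg_left htotn (by positivity)
  calc P.real (bad n) ≤ P.real (badE ∪ (⋃ k, badX k) ∪ badL ∪ badF) := measureReal_mono hsub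
    _ ≤ P.real badE + ∑ k, P.real (badX k) + P.real badL + P.real badF := by
        refine (measureReal_union_le _ _).trans (add_le_add_left
          ((measureReal_union_le _ _).trans (add_le_add_left
          ((measureReal_union_le _ _).trans (add_le_add_right
            (measureReal_iUnion_fintype_le _) _)) _)) _)
    _ ≤ γ / (K + 3) + ∑ _k : Fin K, γ / (K + 3) + γ / (K + 3) + γ / (K + 3) :=
        add_le_add (add_le_add (add_le_add hAn (Finset.sum_le_sum fun k _ => hbn k)) hln) hfn
    _ = γ := by
        rw [Finset.sum_const, Finset.card_univ, Fintype.card_fin, nsmul_eq_mul]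
        field_simp
        ring

end Remainder

theorem theorem4p2 {Ω : Type*} [MeasurableSpace Ω] (P : Measure Ω) [IsProbabilityMeasure P]
    (K R0 : ℕ) (N T : ℕ → ℕ) (β0 : EuclideanSpace ℝ (Fin K))
    (X : ∀ n, Fin K → Ω → Matrix (Fin (N n)) (Fin (T n)) ℝ)
    (lam0 : ∀ n, Ω → Matrix (Fin (N n)) (Fin R0) ℝ)
    (f0 : ∀ n, Ω → Matrix (Fin (T n)) (Fin R0) ℝ)
    (e : ∀ n, Ω → Matrix (Fin (N n)) (Fin (T n)) ℝ)
    (hX : ∀ n k i t, Measurable fun ω => X n k ω i t)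
    (hlam0 : ∀ n i r, Measurable fun ω => lam0 n ω i r)
    (hf0 : ∀ n t r, Measurable fun ω => f0 n ω t r)
    (he : ∀ n i t, Measurable fun ω => e n ω i t)
    (hSF : StrongFactors P lam0 f0)
    (hSN : SpectralNormBounds P X e)
    (hN : Tendsto N atTop atTop) (hT : Tendsto T atTop atTop)
    (κ : ℝ) (hκ : 0 < κ) (hNT : Tendsto (fun n => (N n : ℝ) / T n) atTop (𝓝 (κ ^ 2)))
    (Y : ∀ n, Ω → Matrix (Fin (N n)) (Fin (T n)) ℝ)
    (hY : ∀ n ω, Y n ω = outcome β0 (fun k => X n k ω) (lam0 n ω) (f0 n ω) (e n ω)) :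
    ∃ Lrem : ∀ _ : ℕ, Ω → EuclideanSpace ℝ (Fin K) → ℝ,
      (∀ n ω β,
        profileObj R0 (Y n ω) (fun k => X n k ω) β =
          profileObj R0 (Y n ω) (fun k => X n k ω) β0
          - 2 / Real.sqrt ((N n : ℝ) * T n) *
              ((β - β0).ofLp ⬝ᵥ
                (vecC1 (fun k => X n k ω) (lam0 n ω) (f0 n ω) (e n ω)
                  + vecC2 (fun k => X n k ω) (lam0 n ω) (f0 n ω) (e n ω)))
          + (β - β0).ofLp ⬝ᵥ
              (matW (fun k => X n k ω) (lam0 n ω) (f0 n ω) *ᵥ (β - β0).ofLp)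
          + Lrem n ω β) ∧
      ∀ c : ℕ → ℝ, Tendsto c atTop (𝓝 0) →
        IsLittleOP P
          (fun n ω => ⨆ β ∈ {β : EuclideanSpace ℝ (Fin K) | ‖β - β0‖ ≤ c n},
            ENNReal.ofReal
              (|Lrem n ω β| / (1 + Real.sqrt ((N n : ℝ) * T n) * ‖β - β0‖) ^ 2))
          (fun n => 1 / ((N n : ℝ) * T n)) := by
  -- The remainder is defined as the defect of the expansion, so the identity is algebra for every
  -- `n`, including degenerate dimensions.
  refine ⟨fun n ω β => expansionRemainder R0 β0 (fun k => X n k ω) (lam0 n ω) (f0 n ω) (e n ω) β,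
    fun n ω β => ?_, fun c hc => isLittleOP_expansionRemainder P β0 hSF hSN hN hT hκ hNT hc⟩
  rw [hY]
  simp only [expansionRemainder]
  ring
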